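/- \textbf{Setting.} Let $V\subset\mathbb{R}^d$ be bounded and measurable, $\langle g\rangle:=\int_V g(v)\,dv$, and let $\mathbf m=(m_0,\dots,m_N):V\to\mathbb{R}^{N+1}$ be measurable with $m_0\equiv1$, $|m_i|\le1$, and $m_0,\dots,m_N$ linearly independent modulo null sets. A function $\eta:(0,\infty)\to\mathbb{R}$ is called a \emph{sublinear} entropy if $\eta\in C^3$, $\eta''>0$, $\lim_{z\to\infty}\eta'(z)=0$, $\lim_{z\to0}\eta'(z)=-\infty$ and $\operatorname{range}(\eta')=\operatorname{dom}(\eta_*)=(-\infty,0)$, where $\eta_*(y)=\sup_{z>0}(yz-\eta(z))$ is its Legendre dual. Put $\mathbb{F}(V)=\{g\in L^1(V): g>0 \text{ a.e.}\}$, $\mathcal R=\{\langle \mathbf m g\rangle: g\in\mathbb F(V)\}$, $G_\alpha=\eta_*'(\alpha\cdot\mathbf m)$, $\hat u(\alpha)=\langle \mathbf m\, G_\alpha\rangle$, and for $\gamma\ge0$ $$\hat\alpha_\gamma(u)=\operatorname*{argmax}_{\alpha\in\mathbb{R}^{N+1}}\Big\{\alpha\cdot u-\langle\eta_*(\alpha\cdot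 \mathbf m)\rangle-\tfrac{\gamma}{2}\|\alpha\|^2\Big\},\qquad \hat\alpha:=\hat\alpha_0 .$$ Let $\mathcal C$ be a collision operator and put, with $G=G_{\hat\alpha_\gamma(u)}$, $f_\gamma(u)=\langle v\,\mathbf m\, G\rangle$, $r_\gamma(u)=\langle \mathbf m\,\mathcal C(G)\rangle$, $f:=f_0$, $r:=r_0$, and, for $\gamma>0$, $h_\gamma(u)=\langle\eta(G)\rangle+\frac1{2\gamma}\|\langle \mathbf m\, G\rangle-u\|^2$. Define, for $\gamma>0$, $$h_\gamma(w|u)=h_\gamma(w)-h_\gamma(u)-\hat\alpha_\gamma(u)\cdot(w-u),\qquad f_\gamma(w|u)=f_\gamma(w)-f_\gamma(u)-f_\gamma'(u)(w-u),$$ $$J_\gamma(w,u)=(w-u)\,h_\gamma''(u)\,(f'(u)-f_\gamma'(u)),$$ $$q_\gamma(w,u)=(h_\gamma'(w)-h_\gamma'(u))\cdot r_\gamma(w)-r(u)\cdot(h_\gamma''(u)(w-u)),$$ and, for $M,m>0$, $\mathcal R^{M,m}=\{\hat u(\alpha):\|\alpha\|\le M,\ \alpha\cdot \mathbf m(v)\le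 -m\ \text{for all } v\in V\}$. \textbf{Assumptions.} (a) $\eta$ is a sublinear entropy. (b) $\langle\eta'(g)\,\mathcal C(g)\rangle\le0$ for all $g\in\mathbb F(V)$ for which $\eta'(g)\,\mathcal C(g)$ is integrable; $\mathcal C(G_\alpha)$ is integrable for every $\alpha$ with $G_\alpha\in\mathbb F(V)$; $r$ is Lipschitz continuous on $\mathcal R$, and $r(u)\to0$ as $u\to0$ in $\mathcal R$. (c) If $\alpha\cdot \mathbf m<0$ a.e. on $V$ and $G_\alpha\in L^1(V)$, then $\operatorname{ess\,sup}_V\alpha\cdot \mathbf m<0$. (This holds automatically if $V$ is a bounded interval and the $m_i$ are polynomials.) \textbf{Statement.} Let $M,m,\gamma_0\in(0,\infty)$. Then for all $\gamma\in(0,\gamma_0)$ the maximizer $\hat\alpha_\gamma(w)$ exists and is unique for every $w\in\mathbb{R}^{N+1}$, $h_\gamma$ is differentiable on $\mathbb{R}^{N+1}$, and for $u\in\mathcal R^{M,m}$ the maximizer $\hat\alpha(u)$ exists and is unique and $h_\gamma'$, $f$, $f_\gamma$ are differentiable at $u$. Moreover there are positive constants $C_f,C_J,D_J,C_q,D_q$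 such that $$\|f_\gamma(u_\gamma|u)\|\le C_f\,h_\gamma(u_\gamma|u),$$ $$\|J_\gamma(u_\gamma,u)\|\le C_J\,h_\gamma(u_\gamma|u)+D_J\gamma^2,$$ $$q_\gamma(u_\gamma,u)\le C_q\,h_\gamma(u_\gamma|u)+D_q\gamma^2$$ for all $u_\gamma\in\mathbb{R}^{N+1}$, $u\in\mathcal R^{M,m}$ and $\gamma\in(0,\gamma_0)$. -/

import Mathlib

open MeasureTheory Filter Set
open scoped Topology

noncomputable section

/-- The Legendre dual `η_*(y) = sup_{z > 0} (y z - η z)` of `η : (0, ∞) → ℝ`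
(meaningful at the points `y` of `legendreDom η`). -/
def legendreDual (η : ℝ → ℝ) (y : ℝ) : ℝ :=
  sSup ((fun z => y * z - η z) '' Ioi 0)

/-- The effective domain of the Legendre dual: the points where the supremum is finite. -/
def legendreDom (η : ℝ → ℝ) : Set ℝ :=
  {y | BddAbove ((fun z => y * z - η z) '' Ioi 0)}

/-- Sublinear kinetic entropy functions `η : (0, ∞) → ℝ` (only the values on `(0, ∞)` matter). -/
structure IsSublinearEntropy (η : ℝ → ℝ) : Prop where
  contDiffOn : ContDiffOn ℝ 3 η (Ioi 0)
  deriv2_pos : ∀ z, 0 < z → 0 < deriv (deriv η) z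
  range_deriv : deriv η '' Ioi 0 = Iio 0
  dom_dual : legendreDom η = Iio 0
  tendsto_atTop : Tendsto (deriv η) atTop (𝓝 0)
  tendsto_zero : Tendsto (deriv η) (𝓝[>] 0) atBot

/-- The data of an entropy-based moment closure: the velocity set `V ⊆ ℝ^d`, the vector `m` of
basis functions `m_0, …, m_N` on `V`, the kinetic entropy `η` and the collision operator `coll`,
acting on functions of the velocity. Velocity integrals are always over `V` with respect to
Lebesgue measure, so values of functions outside `V` play no role. -/
structure MomentSystem (d N : ℕ) where
  V : Set (EuclideanSpace ℝ (Fin d))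
  m : EuclideanSpace ℝ (Fin d) → EuclideanSpace ℝ (Fin (N + 1))
  η : ℝ → ℝ
  coll : (EuclideanSpace ℝ (Fin d) → ℝ) → EuclideanSpace ℝ (Fin d) → ℝ

namespace MomentSystem

variable {d N : ℕ} (S : MomentSystem d N)

/-- Lebesgue measure on the velocity set `V`. -/
def μ : Measure (EuclideanSpace ℝ (Fin d)) := volume.restrict S.V

/-- Kinetic densities: integrable functions on `V` with values in `(0, ∞)`. -/
def densities : Set (EuclideanSpace ℝ (Fin d) → ℝ) :=
  {g | Integrable g S.μ ∧ ∀ᵐ v ∂S.μ, 0 < g v}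

/-- The moment vector `⟨m g⟩` of `g`. -/
def moment (g : EuclideanSpace ℝ (Fin d) → ℝ) : EuclideanSpace ℝ (Fin (N + 1)) :=
  ∫ v, g v • S.m v ∂S.μ

/-- The realizable set `R`. -/
def realizable : Set (EuclideanSpace ℝ (Fin (N + 1))) :=
  S.moment '' S.densities

/-- The ansatz `G_α = η_*'(α ⬝ m)`. -/
def ansatz (α : EuclideanSpace ℝ (Fin (N + 1))) (v : EuclideanSpace ℝ (Fin d)) : ℝ :=
  deriv (legendreDual S.η) (inner ℝ α (S.m v))

/-- `û(α) = ⟨m η_*'(α ⬝ m)⟩`. -/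
def uHat (α : EuclideanSpace ℝ (Fin (N + 1))) : EuclideanSpace ℝ (Fin (N + 1)) :=
  S.moment (S.ansatz α)

/-- The multiplier vectors at which `⟨η_*(α ⬝ m)⟩` is finite. At all other multiplier vectors it
is `+∞`, since `η_*` has an affine minorant, and the dual objective is `-∞`. -/
def dualDomain : Set (EuclideanSpace ℝ (Fin (N + 1))) :=
  {α | (∀ᵐ v ∂S.μ, inner ℝ α (S.m v) ∈ legendreDom S.η) ∧
    Integrable (fun v => legendreDual S.η (inner ℝ α (S.m v))) S.μ}

/-- The objective `α ⬝ u - ⟨η_*(α ⬝ m)⟩ - (γ / 2) ‖α‖²` of the regularized dual problem; `γ = 0`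
gives the dual problem of the original method. -/
def dualObjective (γ : ℝ) (u α : EuclideanSpace ℝ (Fin (N + 1))) : ℝ :=
  inner ℝ α u - (∫ v, legendreDual S.η (inner ℝ α (S.m v)) ∂S.μ) - γ / 2 * ‖α‖ ^ 2

/-- `α` solves the (regularized, if `γ > 0`) dual problem for `u`. -/
def IsDualSolution (γ : ℝ) (u α : EuclideanSpace ℝ (Fin (N + 1))) : Prop :=
  α ∈ S.dualDomain ∧ ∀ β ∈ S.dualDomain, S.dualObjective γ u β ≤ S.dualObjective γ u α

/-- The multiplier vector `α̂_γ(u)`, the argmax of the dual problem; `γ = 0` gives `α̂(u)`. -/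
def alphaHat (γ : ℝ) (u : EuclideanSpace ℝ (Fin (N + 1))) : EuclideanSpace ℝ (Fin (N + 1)) :=
  Classical.epsilon (S.IsDualSolution γ u)

/-- The flux `f_γ(u) = ⟨v m G⟩` with `G` the ansatz of `α̂_γ(u)`, a `d × (N + 1)` tensor with the
Euclidean (Frobenius) norm; `γ = 0` gives the original flux `f`. -/
def flux (γ : ℝ) (u : EuclideanSpace ℝ (Fin (N + 1))) : EuclideanSpace ℝ (Fin d × Fin (N + 1)) :=
  WithLp.toLp 2 fun p => ∫ v, v p.1 * S.m v p.2 * S.ansatz (S.alphaHat γ u) v ∂S.μ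

/-- The collision term `r_γ(u) = ⟨m C(G)⟩` with `G` the ansatz of `α̂_γ(u)`; `γ = 0` gives the
original collision term `r`. -/
def source (γ : ℝ) (u : EuclideanSpace ℝ (Fin (N + 1))) : EuclideanSpace ℝ (Fin (N + 1)) :=
  S.moment (S.coll (S.ansatz (S.alphaHat γ u)))

/-- The regularized entropy `h_γ(u) = ⟨η(G)⟩ + (1 / (2γ)) ‖⟨m G⟩ - u‖²`. -/
def entropy (γ : ℝ) (u : EuclideanSpace ℝ (Fin (N + 1))) : ℝ :=
  (∫ v, S.η (S.ansatz (S.alphaHat γ u) v) ∂S.μ) +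
    1 / (2 * γ) * ‖S.moment (S.ansatz (S.alphaHat γ u)) - u‖ ^ 2

/-- The Hessian `h_γ''(u)`, as the derivative of the gradient `h_γ'`. -/
def entropyHess (γ : ℝ) (u : EuclideanSpace ℝ (Fin (N + 1))) :
    EuclideanSpace ℝ (Fin (N + 1)) →L[ℝ] EuclideanSpace ℝ (Fin (N + 1)) :=
  fderiv ℝ (gradient (S.entropy γ)) u

/-- The relative entropy `h_γ(w | u)`. -/
def relEntropy (γ : ℝ) (w u : EuclideanSpace ℝ (Fin (N + 1))) : ℝ :=
  S.entropy γ w - S.entropy γ u - inner ℝ (S.alphaHat γ u) (w - u)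

/-- The relative flux `f_γ(w | u) = f_γ(w) - f_γ(u) - f_γ'(u)(w - u)`. -/
def relFlux (γ : ℝ) (w u : EuclideanSpace ℝ (Fin (N + 1))) :
    EuclideanSpace ℝ (Fin d × Fin (N + 1)) :=
  S.flux γ w - S.flux γ u - fderiv ℝ (S.flux γ) u (w - u)

/-- `J_γ(w, u) = (w - u) h_γ''(u) (f'(u) - f_γ'(u))`: for each space direction `k`, the row vector
`(w - u)ᵀ h_γ''(u)` times the matrix with entries `∂_j (f - f_γ)_{k, l}(u)` (row `l`,
column `j`). -/
def fluxDefect (γ : ℝ) (w u : EuclideanSpace ℝ (Fin (N + 1))) :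
    EuclideanSpace ℝ (Fin d × Fin (N + 1)) :=
  WithLp.toLp 2 fun p => ∑ l : Fin (N + 1),
    inner ℝ (w - u) (S.entropyHess γ u (EuclideanSpace.single l 1)) *
      ((fderiv ℝ (S.flux 0) u - fderiv ℝ (S.flux γ) u) (EuclideanSpace.single p.2 1)) (p.1, l)

/-- `q_γ(w, u) = (h_γ'(w) - h_γ'(u)) ⬝ r_γ(w) - r(u) ⬝ (h_γ''(u)(w - u))`. -/
def sourceDefect (γ : ℝ) (w u : EuclideanSpace ℝ (Fin (N + 1))) : ℝ :=
  inner ℝ (gradient (S.entropy γ) w - gradient (S.entropy γ) u) (S.source γ w) -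
    inner ℝ (S.source 0 u) (S.entropyHess γ u (w - u))

/-- The set `R^{M, m} = {û(α) : ‖α‖ ≤ M, α ⬝ m(v) ≤ -m for all v ∈ V}`; the lower-case parameter
is called `p` here. -/
def realizableBdd (M p : ℝ) : Set (EuclideanSpace ℝ (Fin (N + 1))) :=
  S.uHat '' {α | ‖α‖ ≤ M ∧ ∀ v ∈ S.V, inner ℝ α (S.m v) ≤ -p}

/-- The assumptions on the basis functions: measurable, bounded by one, `m_0 = 1`, and linearly
independent on `V` (modulo null sets). -/
structure BasisAssumption : Prop where
  aestronglyMeasurable : AEStronglyMeasurable S.m S.μ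
  abs_le_one : ∀ v ∈ S.V, ∀ i, |S.m v i| ≤ 1
  zero_eq_one : ∀ v ∈ S.V, S.m v 0 = 1
  independent : ∀ α : EuclideanSpace ℝ (Fin (N + 1)),
    (∀ᵐ v ∂S.μ, inner ℝ α (S.m v) = 0) → α = 0

/-- The assumptions on the collision operator: entropy dissipation; the collision term of the
moment equations is well defined, Lipschitz continuous on the realizable set, and tends to zero
as `u → 0`. -/
structure CollisionAssumption : Prop where
  dissipation : ∀ g ∈ S.densities,
    Integrable (fun v => deriv S.η (g v) * S.coll g v) S.μ →
      ∫ v, deriv S.η (g v) * S.coll g v ∂S.μ ≤ 0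
  integrable : ∀ α, S.ansatz α ∈ S.densities → Integrable (S.coll (S.ansatz α)) S.μ
  lipschitz : ∃ K, LipschitzOnWith K (S.source 0) S.realizable
  tendsto_zero : Tendsto (S.source 0) (𝓝[S.realizable] 0) (𝓝 0)

/-- No concentration: if `α ⬝ m < 0` almost everywhere on `V` but `α ⬝ m` is not essentially
bounded away from zero, then the ansatz `η_*'(α ⬝ m)` is not integrable. -/
def NoConcentration : Prop :=
  ∀ α : EuclideanSpace ℝ (Fin (N + 1)), (∀ᵐ v ∂S.μ, inner ℝ α (S.m v) < 0) →
    Integrable (S.ansatz α) S.μ → ∃ ε > 0, ∀ᵐ v ∂S.μ, inner ℝ α (S.m v) ≤ -ε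

/-- The objects in the estimates are genuine: `α̂_γ(w)` is the unique solution of the regularized
dual problem for every `w`, `h_γ` is differentiable everywhere, and for `u` in the given set
`α̂(u)` is the unique solution of the dual problem and `h_γ'`, `f`, `f_γ` are differentiable
at `u`. -/
structure WellPosed (γ : ℝ) (A : Set (EuclideanSpace ℝ (Fin (N + 1)))) : Prop where
  reg_solution : ∀ w α, S.IsDualSolution γ w α ↔ α = S.alphaHat γ w
  solution : ∀ u ∈ A, ∀ α, S.IsDualSolution 0 u α ↔ α = S.alphaHat 0 u
  entropy_diff : Differentiable ℝ (S.entropy γ)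
  gradient_diff : ∀ u ∈ A, DifferentiableAt ℝ (gradient (S.entropy γ)) u
  flux_diff : ∀ u ∈ A, DifferentiableAt ℝ (S.flux 0) u
  regFlux_diff : ∀ u ∈ A, DifferentiableAt ℝ (S.flux γ) u

end MomentSystem

end

/-! Write `Φ_γ(α) = û(α) + γ α` (`regMap`) on the open cone of multipliers with `α ⬝ m` essentially
bounded away from zero (`negCone`). The gap of the dual objective at `u = Φ_γ(β)` is an integrated
Bregman distance plus `γ/2 ‖β - α‖²` (`dualObjective_sub`), so `α̂_γ` inverts `Φ_γ`. For `γ > 0` the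
image of the cone is open by the inverse function theorem, and closed by Fatou's lemma and the
no-concentration hypothesis, hence everything (`regMap_image`). It follows that `h_γ' = α̂_γ`, and
that, with `β = α̂_γ(w)` and `α = α̂_γ(u)`, `h_γ(w|u)` is the relative entropy of the two ansatz
functions plus `γ/2 ‖β - α‖²` (`relEntropy_eq`).

Uniformity in `γ` comes from compactness: `(γ, α₀) ↦ α̂_γ(û(α₀))` is continuous up to `γ = 0`, so
over `[0, γ₀]` and `R^{M,m}` its values stay in one slab, together with balls of a fixed radius
(`exists_slab_alphaHat`). There `û` has a uniformly coercive derivative and is strongly monotone.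

The multiplier `β` of `w` is arbitrary, which forces a dichotomy (`exists_nearOrFar`). If `β` is
near `α`, the relative entropy dominates `‖β - α‖²` and Taylor remainders are quadratic. If `β` is
far, the relative entropy is bounded below and dominates the `L¹` distance of the ansatz functions
as well as `γ ‖β - α‖`, so linear growth of every term suffices. The regularization error enters
through `‖α - α₀‖ = O(γ)`. In the collision estimate a far `β` has no norm bound uniform in `γ`;
entropy dissipation, `β ⬝ ⟨m C(G_β)⟩ ≤ 0`, removes exactly the term that contains it. -/

open MeasureTheory Filter Set
open scoped Topology

noncomputable section

/-! ### Scalar convex duality for the entropy and its Legendre dual. -/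

namespace IsSublinearEntropy

variable {η : ℝ → ℝ}

theorem contDiffOn_deriv (h : IsSublinearEntropy η) : ContDiffOn ℝ 2 (deriv η) (Ioi 0) :=
  h.contDiffOn.deriv_of_isOpen isOpen_Ioi (by norm_num)

theorem contDiffOn_deriv2 (h : IsSublinearEntropy η) :
    ContDiffOn ℝ 1 (deriv (deriv η)) (Ioi 0) :=
  h.contDiffOn_deriv.deriv_of_isOpen isOpen_Ioi (by norm_num)

theorem strictMonoOn_deriv (h : IsSublinearEntropy η) : StrictMonoOn (deriv η) (Ioi 0) :=
  strictMonoOn_of_deriv_pos (convex_Ioi 0) h.contDiffOn_deriv.continuousOn fun x hx =>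
    h.deriv2_pos x (by simpa using hx)

/-- A strictly convex function lies strictly above its tangents. -/
theorem tangent_lt (h : IsSublinearEntropy η) {a b : ℝ} (ha : 0 < a) (hb : 0 < b) (hab : a ≠ b) :
    η a + deriv η a * (b - a) < η b := by
  have hd : DifferentiableOn ℝ η (Ioi 0) := h.contDiffOn.differentiableOn (by norm_num)
  rcases lt_or_gt_of_ne hab with hlt | hlt
  · obtain ⟨c, hc, he⟩ := exists_deriv_eq_slope η hlt
      (hd.continuousOn.mono fun x hx => ha.trans_le hx.1) (hd.mono fun x hx => ha.trans hx.1)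
    have := h.strictMonoOn_deriv (mem_Ioi.2 ha) (mem_Ioi.2 (ha.trans hc.1)) hc.1
    rw [he, lt_div_iff₀ (by linarith)] at this
    linarith
  · obtain ⟨c, hc, he⟩ := exists_deriv_eq_slope η hlt
      (hd.continuousOn.mono fun x hx => hb.trans_le hx.1) (hd.mono fun x hx => hb.trans hx.1)
    have := h.strictMonoOn_deriv (mem_Ioi.2 (hb.trans hc.1)) (mem_Ioi.2 ha) hc.2
    rw [he, div_lt_iff₀ (by linarith)] at this
    linarith

theorem tangent_le (h : IsSublinearEntropy η) {a b : ℝ} (ha : 0 < a) (hb : 0 < b) :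
    η a + deriv η a * (b - a) ≤ η b := by
  rcases eq_or_ne a b with rfl | hab
  · simp
  · exact (h.tangent_lt ha hb hab).le

theorem legendreDual_deriv (h : IsSublinearEntropy η) {z : ℝ} (hz : 0 < z) :
    legendreDual η (deriv η z) = deriv η z * z - η z := by
  refine IsGreatest.csSup_eq ⟨⟨z, hz, rfl⟩, ?_⟩
  rintro _ ⟨x, hx, rfl⟩
  have := h.tangent_le hz (mem_Ioi.1 hx)
  dsimp only
  linarith

theorem exists_deriv_eq (h : IsSublinearEntropy η) {y : ℝ} (hy : y < 0) :
    ∃ z, 0 < z ∧ deriv η z = y := by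
  have : y ∈ deriv η '' Ioi 0 := h.range_deriv ▸ hy
  simpa using this

theorem deriv_neg (h : IsSublinearEntropy η) {z : ℝ} (hz : 0 < z) : deriv η z < 0 := by
  have : deriv η z ∈ Iio 0 := h.range_deriv ▸ mem_image_of_mem _ hz
  exact this

theorem hasStrictDerivAt_deriv (h : IsSublinearEntropy η) {z : ℝ} (hz : 0 < z) :
    HasStrictDerivAt (deriv η) (deriv (deriv η) z) z :=
  (h.contDiffOn_deriv.contDiffAt (Ioi_mem_nhds hz)).hasStrictDerivAt (by norm_num)

/-- The inverse of `η'`. -/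
def derivInv (η : ℝ → ℝ) : ℝ → ℝ := Function.invFunOn (deriv η) (Ioi 0)

theorem derivInv_deriv (h : IsSublinearEntropy η) {z : ℝ} (hz : 0 < z) :
    derivInv η (deriv η z) = z :=
  h.strictMonoOn_deriv.injOn.leftInvOn_invFunOn hz

theorem hasStrictDerivAt_derivInv (h : IsSublinearEntropy η) {z : ℝ} (hz : 0 < z) :
    HasStrictDerivAt (derivInv η) (deriv (deriv η) z)⁻¹ (deriv η z) :=
  (h.hasStrictDerivAt_deriv hz).to_local_left_inverse (h.deriv2_pos z hz).ne'
    (eventually_of_mem (Ioi_mem_nhds hz) fun _ hx => h.derivInv_deriv hx)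

/-- Envelope argument: in `y x(y) - η(x(y))` with `x = (η')⁻¹` the terms containing `x'` cancel. -/
theorem hasDerivAt_legendreDual (h : IsSublinearEntropy η) {z : ℝ} (hz : 0 < z) :
    HasDerivAt (legendreDual η) z (deriv η z) := by
  have h1 := (h.hasStrictDerivAt_derivInv hz).hasDerivAt
  have h2 : HasDerivAt η (deriv η z) (derivInv η (deriv η z)) := by
    rw [h.derivInv_deriv hz]
    exact ((h.contDiffOn.differentiableOn (by norm_num)).differentiableAt
      (Ioi_mem_nhds hz)).hasDerivAt
  have h3 := ((hasDerivAt_id (deriv η z)).mul h1).sub (h2.comp _ h1)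
  have h4 : HasDerivAt (fun y => y * derivInv η y - η (derivInv η y)) z (deriv η z) := by
    refine h3.congr_deriv ?_
    simp [h.derivInv_deriv hz]
  refine h4.congr_of_eventuallyEq ?_
  filter_upwards [Iio_mem_nhds (h.deriv_neg hz)] with y hy
  obtain ⟨x, hx, rfl⟩ := h.exists_deriv_eq hy
  rw [h.legendreDual_deriv hx, h.derivInv_deriv hx]

theorem deriv_legendreDual (h : IsSublinearEntropy η) {z : ℝ} (hz : 0 < z) :
    deriv (legendreDual η) (deriv η z) = z :=
  (h.hasDerivAt_legendreDual hz).deriv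

theorem dual_pos (h : IsSublinearEntropy η) {y : ℝ} (hy : y < 0) :
    0 < deriv (legendreDual η) y := by
  obtain ⟨z, hz, rfl⟩ := h.exists_deriv_eq hy
  rwa [h.deriv_legendreDual hz]

theorem deriv_dual (h : IsSublinearEntropy η) {y : ℝ} (hy : y < 0) :
    deriv η (deriv (legendreDual η) y) = y := by
  obtain ⟨z, hz, rfl⟩ := h.exists_deriv_eq hy
  rw [h.deriv_legendreDual hz]

theorem entropy_dual (h : IsSublinearEntropy η) {y : ℝ} (hy : y < 0) :
    η (deriv (legendreDual η) y) = y * deriv (legendreDual η) y - legendreDual η y := by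
  obtain ⟨z, hz, rfl⟩ := h.exists_deriv_eq hy
  rw [h.deriv_legendreDual hz, h.legendreDual_deriv hz]
  ring

theorem dual_tangent_lt (h : IsSublinearEntropy η) {a b : ℝ} (ha : a < 0) (hb : b < 0)
    (hab : a ≠ b) :
    legendreDual η a + deriv (legendreDual η) a * (b - a) < legendreDual η b := by
  obtain ⟨x, hx, rfl⟩ := h.exists_deriv_eq ha
  obtain ⟨y, hy, rfl⟩ := h.exists_deriv_eq hb
  rw [h.deriv_legendreDual hx, h.legendreDual_deriv hx, h.legendreDual_deriv hy]
  have := h.tangent_lt hy hx (by rintro rfl; exact hab rfl)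
  linarith

theorem dual_tangent_le (h : IsSublinearEntropy η) {a b : ℝ} (ha : a < 0) (hb : b < 0) :
    legendreDual η a + deriv (legendreDual η) a * (b - a) ≤ legendreDual η b := by
  rcases eq_or_ne a b with rfl | hab
  · simp
  · exact (h.dual_tangent_lt ha hb hab).le

theorem hasDerivAt_dual (h : IsSublinearEntropy η) {y : ℝ} (hy : y < 0) :
    HasDerivAt (deriv (legendreDual η))
      (deriv (deriv η) (deriv (legendreDual η) y))⁻¹ y := by
  obtain ⟨z, hz, rfl⟩ := h.exists_deriv_eq hy
  have h1 := (h.hasStrictDerivAt_derivInv hz).hasDerivAt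
  rw [h.deriv_legendreDual hz]
  refine h1.congr_of_eventuallyEq ?_
  filter_upwards [Iio_mem_nhds hy] with y hy
  obtain ⟨x, hx, rfl⟩ := h.exists_deriv_eq hy
  rw [h.deriv_legendreDual hx, h.derivInv_deriv hx]

theorem dual_deriv_pos (h : IsSublinearEntropy η) {y : ℝ} (hy : y < 0) :
    0 < deriv (deriv (legendreDual η)) y := by
  rw [(h.hasDerivAt_dual hy).deriv]
  exact inv_pos.2 (h.deriv2_pos _ (h.dual_pos hy))

theorem differentiableOn_dual (h : IsSublinearEntropy η) :
    DifferentiableOn ℝ (deriv (legendreDual η)) (Iio 0) := fun _ hy =>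
  (h.hasDerivAt_dual hy).differentiableAt.differentiableWithinAt

/-- Bootstrap of `η_*'' = 1 / η''(η_*')`: continuity of `η_*'` gives continuity of `η_*''`, so
`η_*'` is `C¹`, and a second pass gives the claim. `η ∈ C³` is what makes `η''` itself `C¹`. -/
theorem contDiffOn_dual_deriv (h : IsSublinearEntropy η) :
    ContDiffOn ℝ 1 (deriv (deriv (legendreDual η))) (Iio 0) := by
  have key : ∀ n : ℕ∞, n ≤ 1 → ContDiffOn ℝ n (deriv (legendreDual η)) (Iio 0) →
      ContDiffOn ℝ n (deriv (deriv (legendreDual η))) (Iio 0) := by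
    intro n hn hc
    have h1 : ContDiffOn ℝ n
        (fun y => (deriv (deriv η) (deriv (legendreDual η) y))⁻¹) (Iio 0) :=
      ((h.contDiffOn_deriv2.of_le (by exact_mod_cast hn)).comp hc
        fun y hy => h.dual_pos hy).inv fun y hy => (h.deriv2_pos _ (h.dual_pos hy)).ne'
    exact h1.congr fun y hy => (h.hasDerivAt_dual hy).deriv
  have h0 := key 0 (by norm_num) (contDiffOn_zero.2 h.differentiableOn_dual.continuousOn)
  refine key 1 le_rfl ?_
  have : ((1 : ℕ∞) : WithTop ℕ∞) = 0 + 1 := by norm_num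
  rw [this, contDiffOn_succ_iff_deriv_of_isOpen isOpen_Iio]
  exact ⟨h.differentiableOn_dual, by simp, h0⟩

theorem dual_strictMonoOn (h : IsSublinearEntropy η) :
    StrictMonoOn (deriv (legendreDual η)) (Iio 0) :=
  strictMonoOn_of_deriv_pos (convex_Iio 0) h.differentiableOn_dual.continuousOn fun x hx =>
    h.dual_deriv_pos (by simpa using hx)

theorem dual_mono (h : IsSublinearEntropy η) {a b : ℝ} (hab : a ≤ b) (hb : b < 0) :
    deriv (legendreDual η) a ≤ deriv (legendreDual η) b :=
  h.dual_strictMonoOn.monotoneOn (mem_Iio.2 (hab.trans_lt hb)) (mem_Iio.2 hb) hab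

theorem dual_mono_mul_nonneg (h : IsSublinearEntropy η) {a b : ℝ} (ha : a < 0) (hb : b < 0) :
    0 ≤ (deriv (legendreDual η) a - deriv (legendreDual η) b) * (a - b) := by
  rcases le_total a b with hab | hab
  · exact mul_nonneg_of_nonpos_of_nonpos (by linarith [h.dual_mono hab hb]) (by linarith)
  · exact mul_nonneg (by linarith [h.dual_mono hab ha]) (by linarith)

/-- This blow-up is what prevents limits of multipliers from touching the boundary `α ⬝ m = 0` on a
set of positive measure. -/
theorem dual_tendsto (h : IsSublinearEntropy η) :
    Tendsto (deriv (legendreDual η)) (𝓝[<] 0) atTop := by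
  refine Filter.tendsto_atTop.2 fun K => ?_
  have hK : 0 < max K 1 := by positivity
  filter_upwards [Ioo_mem_nhdsLT (h.deriv_neg hK)] with y hy
  have := h.dual_mono hy.1.le hy.2
  rw [h.deriv_legendreDual hK] at this
  exact (le_max_left _ _).trans this

/-- Outside the effective domain the real `sSup` of an unbounded set takes its default value zero;
this matters only for global measurability. -/
theorem legendreDual_eq_zero (h : IsSublinearEntropy η) {y : ℝ} (hy : 0 ≤ y) :
    legendreDual η y = 0 := by
  refine Real.sSup_of_not_bddAbove fun hb => ?_
  have : y ∈ Iio 0 := h.dom_dual ▸ hb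
  exact absurd (mem_Iio.1 this) (not_lt.2 hy)

theorem continuousOn_legendreDual (h : IsSublinearEntropy η) :
    ContinuousOn (legendreDual η) (Iio 0) := fun y hy => by
  obtain ⟨z, hz, rfl⟩ := h.exists_deriv_eq hy
  exact (h.hasDerivAt_legendreDual hz).continuousAt.continuousWithinAt

theorem measurable_legendreDual (h : IsSublinearEntropy η) : Measurable (legendreDual η) := by
  have := h.continuousOn_legendreDual.measurable_piecewise
    (continuousOn_const (c := (0 : ℝ)) (s := (Iio (0 : ℝ))ᶜ)) measurableSet_Iio
  convert this using 1
  ext y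
  by_cases hy : y < 0
  · simp [hy]
  · simp [hy, h.legendreDual_eq_zero (not_lt.1 hy)]

/-- The Bregman distance of the dual entropy: `η(G | G₀)` for `G = η_*'(y)`, `G₀ = η_*'(y₀)`. -/
def bregman (η : ℝ → ℝ) (y y₀ : ℝ) : ℝ :=
  legendreDual η y₀ - legendreDual η y - deriv (legendreDual η) y * (y₀ - y)

theorem bregman_nonneg (h : IsSublinearEntropy η) {y y₀ : ℝ} (hy : y < 0) (hy₀ : y₀ < 0) :
    0 ≤ bregman η y y₀ := by
  have := h.dual_tangent_le hy hy₀
  unfold bregman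
  linarith

theorem bregman_pos (h : IsSublinearEntropy η) {y y₀ : ℝ} (hy : y < 0) (hy₀ : y₀ < 0)
    (hne : y ≠ y₀) : 0 < bregman η y y₀ := by
  have := h.dual_tangent_lt hy hy₀ hne
  unfold bregman
  linarith

theorem segment_neg {y y₀ t : ℝ} (hy : y < 0) (hy₀ : y₀ < 0) (ht0 : 0 ≤ t) (ht1 : t ≤ 1) :
    y₀ + t * (y - y₀) < 0 := by
  rcases le_total y y₀ with hle | hle <;> nlinarith

/-- The Bregman distance grows along rays. -/
theorem bregman_ray_le (h : IsSublinearEntropy η) {y y₀ t : ℝ} (hy : y < 0) (hy₀ : y₀ < 0)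
    (ht0 : 0 ≤ t) (ht1 : t ≤ 1) :
    bregman η (y₀ + t * (y - y₀)) y₀ ≤ bregman η y y₀ := by
  have hx := segment_neg hy hy₀ ht0 ht1
  have h1 := h.dual_tangent_le hy hx
  have h2 := h.dual_mono_mul_nonneg hy hx
  unfold bregman
  rcases eq_or_lt_of_le ht1 with rfl | ht1
  · apply le_of_eq
    have : y₀ + 1 * (y - y₀) = y := by ring
    rw [this]
  · set x := y₀ + t * (y - y₀) with hxd
    have h3 : 0 ≤ (deriv (legendreDual η) y - deriv (legendreDual η) x) * (y - y₀) := by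
      have : y - x = (1 - t) * (y - y₀) := by rw [hxd]; ring
      rw [this] at h2
      have h4 : 0 < 1 - t := by linarith
      by_contra hneg
      push Not at hneg
      nlinarith
    have h5 : x - y₀ = t * (y - y₀) := by rw [hxd]; ring
    have h6 : 0 ≤ (deriv (legendreDual η) y - deriv (legendreDual η) x) * (x - y₀) := by
      rw [h5]; nlinarith
    nlinarith

theorem dual_ray_le (h : IsSublinearEntropy η) {y y₀ t : ℝ} (hy : y < 0) (hy₀ : y₀ < 0)
    (ht0 : 0 ≤ t) (ht1 : t ≤ 1) :
    (deriv (legendreDual η) (y₀ + t * (y - y₀)) - deriv (legendreDual η) y₀) * (y - y₀) ≤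
      (deriv (legendreDual η) y - deriv (legendreDual η) y₀) * (y - y₀) := by
  have hx := segment_neg hy hy₀ ht0 ht1
  rcases le_total y y₀ with hle | hle
  · have := h.dual_mono (a := y) (b := y₀ + t * (y - y₀)) (by nlinarith) hx
    nlinarith
  · have := h.dual_mono (a := y₀ + t * (y - y₀)) (b := y) (by nlinarith) hy
    nlinarith

/-- The ansatz grows at most linearly in the Bregman distance. -/
theorem dual_le_bregman (h : IsSublinearEntropy η) {y y₀ ε : ℝ} (hε : 0 < ε) (hy : y < 0)
    (hy₀ : y₀ ≤ -ε) :
    ε / 2 * deriv (legendreDual η) y ≤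
      bregman η y y₀ + ε / 2 * deriv (legendreDual η) (-(ε / 2)) := by
  -- The distance `ε` from `y₀` to the endpoint `0` leaves room for the test point `y₀ + ε / 2`; the
  -- shift `ε / 2` becomes the coefficient of `η_*'(y)`.
  have hy1 : y₀ + ε / 2 ≤ -(ε / 2) := by linarith
  have h1 := h.dual_tangent_le (a := y) (b := y₀ + ε / 2) hy (by linarith)
  have h2 := h.dual_tangent_le (a := y₀ + ε / 2) (b := y₀) (by linarith) (by linarith)
  have h3 := h.dual_mono hy1 (by linarith)
  unfold bregman
  nlinarith

theorem abs_dual_sub_le_bregman (h : IsSublinearEntropy η) {y y₀ ε : ℝ} (hε : 0 < ε) (hy : y < 0)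
    (hy₀ : y₀ ≤ -ε) :
    |deriv (legendreDual η) y - deriv (legendreDual η) y₀| ≤
      2 / ε * bregman η y y₀ + 2 * deriv (legendreDual η) (-(ε / 2)) := by
  have h1 := h.dual_le_bregman hε hy hy₀
  have h2 := h.dual_pos hy
  have h3 := h.dual_pos (y := y₀) (by linarith)
  have h4 := h.dual_mono (a := y₀) (b := -(ε / 2)) (by linarith) (by linarith)
  have h5 : deriv (legendreDual η) y ≤
      2 / ε * bregman η y y₀ + deriv (legendreDual η) (-(ε / 2)) := by
    have : 2 / ε * (ε / 2 * deriv (legendreDual η) y) ≤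
        2 / ε * (bregman η y y₀ + ε / 2 * deriv (legendreDual η) (-(ε / 2))) := by gcongr
    field_simp at this ⊢
    linarith
  rw [abs_le]
  constructor <;> linarith [h.bregman_nonneg hy (y₀ := y₀) (by linarith), abs_nonneg y]

/-- Bounds for the ansatz on a compact interval of `(-∞, 0)`. -/
structure DualBounds (η : ℝ → ℝ) (I : Set ℝ) (c C : ℝ) : Prop where
  pos : 0 < c
  nonneg : 0 ≤ C
  abs_le : ∀ a ∈ I, |deriv (legendreDual η) a| ≤ C
  strong_mono : ∀ a ∈ I, ∀ b ∈ I,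
    c * (a - b) ^ 2 ≤ (deriv (legendreDual η) a - deriv (legendreDual η) b) * (a - b)
  abs_deriv_le : ∀ a ∈ I, |deriv (deriv (legendreDual η)) a| ≤ C
  le_deriv : ∀ a ∈ I, c ≤ deriv (deriv (legendreDual η)) a
  abs_deriv_sub_le : ∀ a ∈ I, ∀ b ∈ I,
    |deriv (deriv (legendreDual η)) a - deriv (deriv (legendreDual η)) b| ≤ C * |a - b|
  taylor : ∀ a ∈ I, ∀ b ∈ I, ∀ x ∈ I,
    |deriv (legendreDual η) b - deriv (legendreDual η) x -
      deriv (deriv (legendreDual η)) a * (b - x)| ≤ C * (|b - a| + |x - a|) * |b - x|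
  legendre_le : ∀ a ∈ I, |legendreDual η a| ≤ C
  lip : ∀ a ∈ I, ∀ b ∈ I,
    |deriv (legendreDual η) a - deriv (legendreDual η) b| ≤ C * |a - b|

theorem exists_dualBounds (h : IsSublinearEntropy η) {R ε : ℝ} (hε : 0 < ε) :
    ∃ c C, DualBounds η (Icc (-R) (-ε)) c C := by
  have hsub : Icc (-R) (-ε) ⊆ Iio 0 := fun x hx => by
    have := hx.2; simp only [mem_Iio]; linarith
  have hcomp : IsCompact (Icc (-R) (-ε)) := isCompact_Icc
  obtain ⟨C1, hC1⟩ := hcomp.exists_bound_of_continuousOn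
    (h.differentiableOn_dual.continuousOn.mono hsub)
  obtain ⟨C2, hC2⟩ := hcomp.exists_bound_of_continuousOn
    (h.contDiffOn_dual_deriv.continuousOn.mono hsub)
  obtain ⟨C4, hC4⟩ := hcomp.exists_bound_of_continuousOn
    (h.continuousOn_legendreDual.mono hsub)
  obtain ⟨K, hK⟩ := (h.contDiffOn_dual_deriv.mono hsub).exists_lipschitzOnWith
    (by norm_num) (convex_Icc _ _) hcomp
  have hK' : ∀ a ∈ Icc (-R) (-ε), ∀ b ∈ Icc (-R) (-ε),
      |deriv (deriv (legendreDual η)) a - deriv (deriv (legendreDual η)) b| ≤ K * |a - b| := by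
    intro a ha b hb
    simpa [Real.dist_eq] using hK.dist_le_mul a ha b hb
  obtain ⟨c, hc, hcle⟩ : ∃ c > 0, ∀ a ∈ Icc (-R) (-ε),
      c ≤ deriv (deriv (legendreDual η)) a := by
    rcases (Icc (-R) (-ε)).eq_empty_or_nonempty with he | hne
    · exact ⟨1, one_pos, by simp [he]⟩
    · obtain ⟨x, hx, hmin⟩ := hcomp.exists_isMinOn hne
        (h.contDiffOn_dual_deriv.continuousOn.mono hsub)
      exact ⟨_, h.dual_deriv_pos (hsub hx), fun a ha => hmin ha⟩
  have hmono : ∀ a ∈ Icc (-R) (-ε), ∀ b ∈ Icc (-R) (-ε), a ≤ b →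
      c * (b - a) ≤ deriv (legendreDual η) b - deriv (legendreDual η) a := by
    refine (convex_Icc _ _).mul_sub_le_image_sub_of_le_deriv
      (h.differentiableOn_dual.continuousOn.mono hsub)
      (h.differentiableOn_dual.mono (interior_subset.trans hsub)) fun x hx =>
        hcle x (interior_subset hx)
  have hK0 := K.2
  have h1 := le_abs_self C1
  have h2 := le_abs_self C2
  have h4 := le_abs_self C4
  have p1 := abs_nonneg C1
  have p2 := abs_nonneg C2
  have p4 := abs_nonneg C4
  refine ⟨c, |C1| + |C2| + |C4| + K, hc, by positivity, fun a ha => ?_, fun a ha b hb => ?_,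
    fun a ha => ?_, hcle, fun a ha b hb => ?_, fun a ha b hb x hx => ?_, fun a ha => ?_,
    fun a ha b hb => ?_⟩
  · have := hC1 a ha
    rw [Real.norm_eq_abs] at this
    linarith
  · rcases le_total a b with hab | hab
    · nlinarith [hmono a ha b hb hab]
    · nlinarith [hmono b hb a ha hab]
  · have := hC2 a ha
    rw [Real.norm_eq_abs] at this
    linarith
  · refine (hK' a ha b hb).trans ?_
    gcongr
    linarith
  -- Mean value inequality for `η_*'(y) - η_*''(a) y`; every `y` between `x` and `b` is within `|b -
  -- a| + |x - a|` of `a`.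
  · have hsub' : uIcc x b ⊆ Icc (-R) (-ε) := (convex_Icc _ _).ordConnected.uIcc_subset hx hb
    have hd : ∀ y ∈ uIcc x b, HasDerivAt
        (fun y => deriv (legendreDual η) y - deriv (deriv (legendreDual η)) a * y)
        (deriv (deriv (legendreDual η)) y - deriv (deriv (legendreDual η)) a) y := by
      intro y hy
      have := (h.hasDerivAt_dual (hsub (hsub' hy))).differentiableAt.hasDerivAt
      exact (this.sub ((hasDerivAt_id y).const_mul (deriv (deriv (legendreDual η)) a))).congr_deriv
        (by simp)
    have := Convex.norm_image_sub_le_of_norm_deriv_le (C := K * (|b - a| + |x - a|))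
      (fun y hy => (hd y hy).differentiableAt) (fun y hy => ?_) (convex_uIcc x b)
      left_mem_uIcc right_mem_uIcc
    · rw [Real.norm_eq_abs, Real.norm_eq_abs] at this
      calc _ = |deriv (legendreDual η) b - deriv (deriv (legendreDual η)) a * b -
            (deriv (legendreDual η) x - deriv (deriv (legendreDual η)) a * x)| := by
            congr 1; ring
        _ ≤ _ := this
        _ ≤ _ := by gcongr; linarith
    · rw [(hd y hy).deriv, Real.norm_eq_abs]
      refine (hK' y (hsub' hy) a ha).trans ?_
      gcongr
      rcases mem_uIcc.1 hy with hy | hy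
      · rw [abs_le]
        constructor <;>
          linarith [neg_abs_le (x - a), le_abs_self (b - a), abs_nonneg (x - a), abs_nonneg (b - a)]
      · rw [abs_le]
        constructor <;>
          linarith [neg_abs_le (b - a), le_abs_self (x - a), abs_nonneg (x - a), abs_nonneg (b - a)]
  · have := hC4 a ha
    rw [Real.norm_eq_abs] at this
    linarith
  · have := Convex.norm_image_sub_le_of_norm_deriv_le
      (fun y hy => (h.hasDerivAt_dual (hsub hy)).differentiableAt) hC2 (convex_Icc _ _) hb ha
    rw [Real.norm_eq_abs, Real.norm_eq_abs] at this
    refine this.trans ?_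
    gcongr
    linarith

/-- With the midpoint `z`, two tangent inequalities give a lower bound `(η_*'(z) - η_*'(y)) (z -
y)`, and strong monotonicity at half the distance produces the factor `1/4`. -/
theorem DualBounds.bregman_ge (h : IsSublinearEntropy η) {R ε c C : ℝ} (hε : 0 < ε)
    (hb : DualBounds η (Icc (-R) (-ε)) c C) {y y₀ : ℝ} (hy : y ∈ Icc (-R) (-ε))
    (hy₀ : y₀ ∈ Icc (-R) (-ε)) : c / 4 * (y - y₀) ^ 2 ≤ bregman η y y₀ := by
  have hz : (y + y₀) / 2 ∈ Icc (-R) (-ε) :=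
    ⟨by linarith [hy.1, hy₀.1], by linarith [hy.2, hy₀.2]⟩
  have h1 := h.dual_tangent_le (a := (y + y₀) / 2) (b := y₀) (by linarith [hz.2])
    (by linarith [hy₀.2])
  have h2 := h.dual_tangent_le (a := y) (b := (y + y₀) / 2) (by linarith [hy.2])
    (by linarith [hz.2])
  have h3 := hb.strong_mono _ hz _ hy
  unfold bregman
  nlinarith

end IsSublinearEntropy

/-! ### Moments of the ansatz as smooth functions of the multiplier. -/

namespace MomentSystem

variable {d N : ℕ} {S : MomentSystem d N}

/-- The standing assumptions on the velocity set, the entropy and the basis functions. -/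
structure Regular (S : MomentSystem d N) : Prop where
  measurableSet : MeasurableSet S.V
  isBounded : Bornology.IsBounded S.V
  entropy : IsSublinearEntropy S.η
  basis : S.BasisAssumption

/-- Multiplier vectors of norm at most `R` with `α ⬝ m ≤ -ε` almost everywhere. -/
def slab (S : MomentSystem d N) (R ε : ℝ) : Set (EuclideanSpace ℝ (Fin (N + 1))) :=
  {α | ‖α‖ ≤ R ∧ ∀ᵐ v ∂S.μ, inner ℝ α (S.m v) ≤ -ε}

/-- Multiplier vectors for which `α ⬝ m` is essentially bounded away from zero. -/
def negCone (S : MomentSystem d N) : Set (EuclideanSpace ℝ (Fin (N + 1))) :=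
  {α | ∃ ε > 0, ∀ᵐ v ∂S.μ, inner ℝ α (S.m v) ≤ -ε}

theorem mem_slab_of_negCone {α : EuclideanSpace ℝ (Fin (N + 1))} (hα : α ∈ S.negCone) :
    ∃ ε > 0, α ∈ S.slab ‖α‖ ε :=
  let ⟨ε, hε, h⟩ := hα
  ⟨ε, hε, le_rfl, h⟩

theorem mem_negCone_of_slab {R ε : ℝ} (hε : 0 < ε) {α : EuclideanSpace ℝ (Fin (N + 1))}
    (hα : α ∈ S.slab R ε) : α ∈ S.negCone := ⟨ε, hε, hα.2⟩

/-- Bounded measurable kernels. -/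
structure IsKernel (S : MomentSystem d N) {F : Type*} [NormedAddCommGroup F]
    (k : EuclideanSpace ℝ (Fin d) → F) (B : ℝ) : Prop where
  meas : AEStronglyMeasurable k S.μ
  nonneg : 0 ≤ B
  bound : ∀ᵐ v ∂S.μ, ‖k v‖ ≤ B

/-- The operator `ξ ↦ ⟨g (m ⬝ ξ) k⟩`. -/
def kernelOp (S : MomentSystem d N) {F : Type*} [NormedAddCommGroup F] [NormedSpace ℝ F]
    (g : EuclideanSpace ℝ (Fin d) → ℝ) (k : EuclideanSpace ℝ (Fin d) → F) :
    EuclideanSpace ℝ (Fin (N + 1)) →L[ℝ] F :=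
  ∫ v, g v • (innerSL ℝ (S.m v)).smulRight (k v) ∂S.μ

/-- The moment `⟨G_α k⟩`. -/
def wMoment (S : MomentSystem d N) {F : Type*} [NormedAddCommGroup F] [NormedSpace ℝ F]
    (k : EuclideanSpace ℝ (Fin d) → F) (α : EuclideanSpace ℝ (Fin (N + 1))) : F :=
  ∫ v, S.ansatz α v • k v ∂S.μ

/-- The derivative of `⟨G_α k⟩` in `α`. -/
def wDeriv (S : MomentSystem d N) {F : Type*} [NormedAddCommGroup F] [NormedSpace ℝ F]
    (k : EuclideanSpace ℝ (Fin d) → F) (α : EuclideanSpace ℝ (Fin (N + 1))) :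
    EuclideanSpace ℝ (Fin (N + 1)) →L[ℝ] F :=
  S.kernelOp (fun v => deriv (deriv (legendreDual S.η)) (inner ℝ α (S.m v))) k

namespace Regular

variable (hS : S.Regular)
include hS

theorem isFiniteMeasure : IsFiniteMeasure S.μ := by
  refine ⟨?_⟩
  rw [μ, Measure.restrict_apply_univ]
  exact hS.isBounded.measure_lt_top

theorem norm_m_le : ∀ᵐ v ∂S.μ, ‖S.m v‖ ≤ (N : ℝ) + 1 := by
  refine ae_restrict_of_forall_mem hS.measurableSet fun v hv => ?_
  rw [EuclideanSpace.norm_eq]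
  refine Real.sqrt_le_iff.2 ⟨by positivity, ?_⟩
  calc ∑ i, ‖S.m v i‖ ^ 2 ≤ ∑ _i : Fin (N + 1), (1 : ℝ) := by
        refine Finset.sum_le_sum fun i _ => ?_
        have := hS.basis.abs_le_one v hv i
        rw [Real.norm_eq_abs]
        exact pow_le_one₀ (abs_nonneg _) this
    _ = (N : ℝ) + 1 := by simp
    _ ≤ _ := by nlinarith [(Nat.cast_nonneg N : (0 : ℝ) ≤ N)]

theorem isKernel_m : S.IsKernel S.m ((N : ℝ) + 1) :=
  ⟨hS.basis.aestronglyMeasurable, by positivity, hS.norm_m_le⟩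

theorem abs_inner_le (α : EuclideanSpace ℝ (Fin (N + 1))) :
    ∀ᵐ v ∂S.μ, |inner ℝ α (S.m v)| ≤ ‖α‖ * ((N : ℝ) + 1) := by
  filter_upwards [hS.norm_m_le] with v hv
  exact (abs_real_inner_le_norm _ _).trans (by gcongr)

theorem slab_mem_Icc {R ε : ℝ} {α : EuclideanSpace ℝ (Fin (N + 1))} (hα : α ∈ S.slab R ε) :
    ∀ᵐ v ∂S.μ, inner ℝ α (S.m v) ∈ Icc (-(R * ((N : ℝ) + 1))) (-ε) := by
  filter_upwards [hS.abs_inner_le α, hα.2] with v h1 h2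
  refine ⟨?_, h2⟩
  have : ‖α‖ * ((N : ℝ) + 1) ≤ R * ((N : ℝ) + 1) := by gcongr; exact hα.1
  linarith [neg_abs_le (inner ℝ α (S.m v))]

/-- Moving the multiplier by `r` changes `α ⬝ m` by at most `r (N + 1)`. -/
theorem closedBall_subset_slab {R ε r : ℝ} (hr : r * ((N : ℝ) + 1) ≤ ε / 2)
    {α : EuclideanSpace ℝ (Fin (N + 1))} (hα : α ∈ S.slab R ε) :
    Metric.closedBall α r ⊆ S.slab (R + r) (ε / 2) := by
  intro β hβ
  rw [mem_closedBall_iff_norm] at hβ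
  refine ⟨?_, ?_⟩
  · calc ‖β‖ = ‖α + (β - α)‖ := by congr 1; abel
      _ ≤ ‖α‖ + ‖β - α‖ := norm_add_le _ _
      _ ≤ R + r := add_le_add hα.1 hβ
  · filter_upwards [hα.2, hS.abs_inner_le (β - α)] with v h1 h2
    rw [inner_sub_left] at h2
    have : ‖β - α‖ * ((N : ℝ) + 1) ≤ r * ((N : ℝ) + 1) := by gcongr
    linarith [le_abs_self (inner ℝ β (S.m v) - inner ℝ α (S.m v))]

theorem isOpen_negCone : IsOpen S.negCone := by
  rw [Metric.isOpen_iff]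
  intro α hα
  obtain ⟨ε, hε, h⟩ := mem_slab_of_negCone hα
  have hN : (0 : ℝ) < (N : ℝ) + 1 := by positivity
  refine ⟨ε / 2 / ((N : ℝ) + 1), by positivity, fun β hβ => ?_⟩
  exact mem_negCone_of_slab (half_pos hε) (hS.closedBall_subset_slab
    (by rw [div_mul_cancel₀ _ hN.ne']) h (Metric.ball_subset_closedBall hβ))

theorem aemeas_inner (α : EuclideanSpace ℝ (Fin (N + 1))) :
    AEStronglyMeasurable (fun v => inner ℝ α (S.m v)) S.μ :=
  aestronglyMeasurable_const.inner hS.basis.aestronglyMeasurable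

theorem aemeas_ansatz (α : EuclideanSpace ℝ (Fin (N + 1))) :
    AEStronglyMeasurable (S.ansatz α) S.μ :=
  ((measurable_deriv _).comp_aemeasurable (hS.aemeas_inner α).aemeasurable).aestronglyMeasurable

theorem aemeas_ansatz_deriv (α : EuclideanSpace ℝ (Fin (N + 1))) :
    AEStronglyMeasurable (fun v => deriv (deriv (legendreDual S.η)) (inner ℝ α (S.m v))) S.μ :=
  ((measurable_deriv _).comp_aemeasurable (hS.aemeas_inner α).aemeasurable).aestronglyMeasurable

theorem exists_bounds {R ε : ℝ} (hε : 0 < ε) : ∃ c C,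
    IsSublinearEntropy.DualBounds S.η (Icc (-(R * ((N : ℝ) + 1))) (-ε)) c C :=
  hS.entropy.exists_dualBounds hε

theorem integrable_of_bounded {F : Type*} [NormedAddCommGroup F]
    {f : EuclideanSpace ℝ (Fin d) → F} {C : ℝ} (hf : AEStronglyMeasurable f S.μ)
    (hb : ∀ᵐ v ∂S.μ, ‖f v‖ ≤ C) : Integrable f S.μ := by
  have := hS.isFiniteMeasure
  exact Integrable.of_bound hf C hb

theorem ansatz_bounded {α : EuclideanSpace ℝ (Fin (N + 1))} (hα : α ∈ S.negCone) :
    ∃ C, ∀ᵐ v ∂S.μ, ‖S.ansatz α v‖ ≤ C := by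
  obtain ⟨ε, hε, h⟩ := mem_slab_of_negCone hα
  obtain ⟨c, C, hb⟩ := hS.exists_bounds hε (R := ‖α‖)
  refine ⟨C, ?_⟩
  filter_upwards [hS.slab_mem_Icc h] with v hv
  exact hb.abs_le _ hv

theorem integrable_ansatz {α : EuclideanSpace ℝ (Fin (N + 1))} (hα : α ∈ S.negCone) :
    Integrable (S.ansatz α) S.μ :=
  let ⟨_, hC⟩ := hS.ansatz_bounded hα
  hS.integrable_of_bounded (hS.aemeas_ansatz α) hC

theorem ansatz_mem_densities {α : EuclideanSpace ℝ (Fin (N + 1))} (hα : α ∈ S.negCone) :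
    S.ansatz α ∈ S.densities := by
  refine ⟨hS.integrable_ansatz hα, ?_⟩
  obtain ⟨ε, hε, h⟩ := hα
  filter_upwards [h] with v hv
  exact hS.entropy.dual_pos (by linarith)

variable {F : Type*} [NormedAddCommGroup F] [NormedSpace ℝ F]
variable {k : EuclideanSpace ℝ (Fin d) → F} {B : ℝ}

omit hS in
theorem integrable_smul_kernel (hk : S.IsKernel k B) {g : EuclideanSpace ℝ (Fin d) → ℝ}
    (hg : Integrable g S.μ) : Integrable (fun v => g v • k v) S.μ :=
  hg.smul_bdd B hk.meas hk.bound

theorem integrable_ansatz_smul (hk : S.IsKernel k B) {α : EuclideanSpace ℝ (Fin (N + 1))}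
    (hα : α ∈ S.negCone) : Integrable (fun v => S.ansatz α v • k v) S.μ :=
  integrable_smul_kernel hk (hS.integrable_ansatz hα)

theorem integrable_kernelOp (hk : S.IsKernel k B) {g : EuclideanSpace ℝ (Fin d) → ℝ}
    (hg : Integrable g S.μ) :
    Integrable (fun v => g v • (innerSL ℝ (S.m v)).smulRight (k v)) S.μ := by
  refine hg.smul_bdd (((N : ℝ) + 1) * B) ?_ ?_
  · exact (ContinuousLinearMap.smulRightL ℝ (EuclideanSpace ℝ (Fin (N + 1)))
      F).aestronglyMeasurable_comp₂
      ((innerSL ℝ).continuous.comp_aestronglyMeasurable hS.basis.aestronglyMeasurable) hk.meas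
  · filter_upwards [hS.norm_m_le, hk.bound] with v h1 h2
    rw [ContinuousLinearMap.norm_smulRight_apply, innerSL_apply_norm]
    have := hk.nonneg
    gcongr

theorem kernelOp_apply [CompleteSpace F] (hk : S.IsKernel k B)
    {g : EuclideanSpace ℝ (Fin d) → ℝ}
    (hg : Integrable g S.μ) (ξ : EuclideanSpace ℝ (Fin (N + 1))) :
    S.kernelOp g k ξ = ∫ v, (g v * inner ℝ ξ (S.m v)) • k v ∂S.μ := by
  rw [kernelOp, ContinuousLinearMap.integral_apply (hS.integrable_kernelOp hk hg)]
  refine integral_congr_ae (Eventually.of_forall fun v => ?_)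
  simp [smul_smul, real_inner_comm]

theorem norm_kernelOp_le (hk : S.IsKernel k B) {g : EuclideanSpace ℝ (Fin d) → ℝ} {C : ℝ}
    (hg : ∀ᵐ v ∂S.μ, |g v| ≤ C) :
    ‖S.kernelOp g k‖ ≤ C * (((N : ℝ) + 1) * B) * S.μ.real univ := by
  have := hS.isFiniteMeasure
  refine norm_integral_le_of_norm_le_const ?_
  filter_upwards [hS.norm_m_le, hk.bound, hg] with v h1 h2 h3
  rw [norm_smul, ContinuousLinearMap.norm_smulRight_apply, innerSL_apply_norm, Real.norm_eq_abs]
  have := hk.nonneg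
  have : 0 ≤ C := (abs_nonneg _).trans h3
  gcongr

theorem integrable_ansatz_deriv {α : EuclideanSpace ℝ (Fin (N + 1))} (hα : α ∈ S.negCone) :
    Integrable (fun v => deriv (deriv (legendreDual S.η)) (inner ℝ α (S.m v))) S.μ := by
  obtain ⟨ε, hε, h⟩ := mem_slab_of_negCone hα
  obtain ⟨c, C, hb⟩ := hS.exists_bounds hε (R := ‖α‖)
  refine hS.integrable_of_bounded (hS.aemeas_ansatz_deriv α) (C := C) ?_
  filter_upwards [hS.slab_mem_Icc h] with v hv
  exact hb.abs_deriv_le _ hv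

/-- On a slab `α ⬝ m` takes values a.e. in one compact interval of `(-∞, 0)`, so the scalar bounds
integrate. The Taylor bound has three points: `β' = α` gives the quadratic remainder, and free `β`,
`β'` give strict differentiability. -/
theorem exists_wMoment_bounds [CompleteSpace F] (hk : S.IsKernel k B) {R ε : ℝ} (hε : 0 < ε) :
    ∃ C, 0 ≤ C ∧ (∀ α ∈ S.slab R ε, ‖S.wDeriv k α‖ ≤ C) ∧
      (∀ α ∈ S.slab R ε, ∀ β ∈ S.slab R ε, ‖S.wDeriv k α - S.wDeriv k β‖ ≤ C * ‖α - β‖) ∧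
      (∀ α ∈ S.slab R ε, ∀ β ∈ S.slab R ε, ∀ β' ∈ S.slab R ε,
        ‖S.wMoment k β - S.wMoment k β' - S.wDeriv k α (β - β')‖ ≤
          C * (‖β - α‖ + ‖β' - α‖) * ‖β - β'‖) ∧
      (∀ α ∈ S.slab R ε, ∀ β ∈ S.slab R ε, ‖S.wMoment k α - S.wMoment k β‖ ≤ C * ‖α - β‖) := by
  have := hS.isFiniteMeasure
  obtain ⟨c, C, hb⟩ := hS.exists_bounds hε (R := R)
  have hC := hb.nonneg
  have hB := hk.nonneg
  have hμ : 0 ≤ S.μ.real univ := measureReal_nonneg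
  have hN : (1 : ℝ) ≤ (N : ℝ) + 1 := by linarith [(Nat.cast_nonneg N : (0 : ℝ) ≤ N)]
  have hN0 : (0 : ℝ) ≤ (N : ℝ) + 1 := by linarith
  set D := C * ((N : ℝ) + 1) * (((N : ℝ) + 1) * B) * S.μ.real univ with hD
  have hD0 : 0 ≤ D := by positivity
  have hneg : ∀ α ∈ S.slab R ε, α ∈ S.negCone := fun α hα => mem_negCone_of_slab hε hα
  have hder : ∀ α ∈ S.slab R ε, ‖S.wDeriv k α‖ ≤ D := by
    intro α hα
    refine (hS.norm_kernelOp_le hk (C := C) ?_).trans ?_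
    · filter_upwards [hS.slab_mem_Icc hα] with v hv using hb.abs_deriv_le _ hv
    · rw [hD]
      gcongr
      nlinarith
  have htay : ∀ α ∈ S.slab R ε, ∀ β ∈ S.slab R ε, ∀ β' ∈ S.slab R ε,
        ‖S.wMoment k β - S.wMoment k β' - S.wDeriv k α (β - β')‖ ≤
          D * (‖β - α‖ + ‖β' - α‖) * ‖β - β'‖ := by
    intro α hα β hβ β' hβ'
    have hi := hS.integrable_kernelOp hk (hS.integrable_ansatz_deriv (hneg α hα))
    have h1 : S.wMoment k β - S.wMoment k β' - S.wDeriv k α (β - β') =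
        ∫ v, (S.ansatz β v - S.ansatz β' v - deriv (deriv (legendreDual S.η))
          (inner ℝ α (S.m v)) * inner ℝ (β - β') (S.m v)) • k v ∂S.μ := by
      have hi2 := hi.apply_continuousLinearMap (β - β')
      have hi3 : Integrable (fun v => (deriv (deriv (legendreDual S.η))
          (inner ℝ α (S.m v)) * inner ℝ (β - β') (S.m v)) • k v) S.μ := by
        refine hi2.congr (Eventually.of_forall fun v => ?_)
        simp [smul_smul, real_inner_comm]
      rw [wDeriv, hS.kernelOp_apply hk (hS.integrable_ansatz_deriv (hneg α hα)), wMoment, wMoment,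
        ← integral_sub (hS.integrable_ansatz_smul hk (hneg β hβ))
          (hS.integrable_ansatz_smul hk (hneg β' hβ')), ← integral_sub _ hi3]
      · simp only [sub_smul]
      · exact (hS.integrable_ansatz_smul hk (hneg β hβ)).sub
          (hS.integrable_ansatz_smul hk (hneg β' hβ'))
    rw [h1]
    refine (norm_integral_le_of_norm_le_const (C := C * ((‖β - α‖ + ‖β' - α‖) * ((N : ℝ) + 1)) *
      (‖β - β'‖ * ((N : ℝ) + 1)) * B) ?_).trans (le_of_eq (by rw [hD]; ring))
    filter_upwards [hS.slab_mem_Icc hα, hS.slab_mem_Icc hβ, hS.slab_mem_Icc hβ', hk.bound,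
      hS.abs_inner_le (β - α), hS.abs_inner_le (β' - α), hS.abs_inner_le (β - β')]
      with v h1 h2 h3 h4 h5 h6 h7
    rw [norm_smul, Real.norm_eq_abs]
    have := hb.taylor _ h1 _ h2 _ h3
    rw [inner_sub_left] at h5 h6 h7
    refine mul_le_mul ?_ h4 (norm_nonneg _) (by positivity)
    rw [inner_sub_left]
    refine this.trans ?_
    rw [add_mul]
    gcongr
  refine ⟨D, hD0, hder, ?_, htay, ?_⟩
  · intro α hα β hβ
    have h1 : S.wDeriv k α - S.wDeriv k β = S.kernelOp (fun v =>
        deriv (deriv (legendreDual S.η)) (inner ℝ α (S.m v)) -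
        deriv (deriv (legendreDual S.η)) (inner ℝ β (S.m v))) k := by
      rw [wDeriv, wDeriv, kernelOp, kernelOp, kernelOp, ← integral_sub]
      · simp only [sub_smul]
      · exact hS.integrable_kernelOp hk (hS.integrable_ansatz_deriv (hneg α hα))
      · exact hS.integrable_kernelOp hk (hS.integrable_ansatz_deriv (hneg β hβ))
    rw [h1]
    refine (hS.norm_kernelOp_le hk (C := C * (‖α - β‖ * ((N : ℝ) + 1))) ?_).trans
      (le_of_eq (by rw [hD]; ring))
    filter_upwards [hS.slab_mem_Icc hα, hS.slab_mem_Icc hβ, hS.abs_inner_le (α - β)]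
      with v h1 h2 h3
    refine (hb.abs_deriv_sub_le _ h1 _ h2).trans ?_
    rw [inner_sub_left] at h3
    gcongr
  · intro α hα β hβ
    rw [wMoment, wMoment, ← integral_sub (hS.integrable_ansatz_smul hk (hneg α hα))
      (hS.integrable_ansatz_smul hk (hneg β hβ))]
    refine (norm_integral_le_of_norm_le_const (C := C * (‖α - β‖ * ((N : ℝ) + 1)) * B) ?_).trans ?_
    · filter_upwards [hS.slab_mem_Icc hα, hS.slab_mem_Icc hβ, hk.bound, hS.abs_inner_le (α - β)]
        with v h1 h2 h3 h4
      rw [← sub_smul, norm_smul, Real.norm_eq_abs]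
      refine mul_le_mul ?_ h3 (norm_nonneg _) (by positivity)
      refine (hb.lip _ h1 _ h2).trans ?_
      rw [inner_sub_left] at h4
      gcongr
    · have h0 : 0 ≤ C * ((N : ℝ) + 1) * B * S.μ.real univ * ‖α - β‖ := by positivity
      calc _ = 1 * (C * ((N : ℝ) + 1) * B * S.μ.real univ * ‖α - β‖) := by ring
        _ ≤ ((N : ℝ) + 1) * (C * ((N : ℝ) + 1) * B * S.μ.real univ * ‖α - β‖) := by gcongr
        _ = _ := by rw [hD]; ring

theorem hasStrictFDerivAt_wMoment [CompleteSpace F] (hk : S.IsKernel k B)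
    {α : EuclideanSpace ℝ (Fin (N + 1))} (hα : α ∈ S.negCone) :
    HasStrictFDerivAt (S.wMoment k) (S.wDeriv k α) α := by
  obtain ⟨ε, hε, h⟩ := mem_slab_of_negCone hα
  have hN : (0 : ℝ) < (N : ℝ) + 1 := by positivity
  obtain ⟨r, hr0, hr⟩ : ∃ r > 0, r * ((N : ℝ) + 1) ≤ ε / 2 :=
    ⟨ε / 2 / ((N : ℝ) + 1), by positivity, by rw [div_mul_cancel₀ _ hN.ne']⟩
  have hsub := hS.closedBall_subset_slab hr h
  obtain ⟨C, hC, -, -, htay, -⟩ := hS.exists_wMoment_bounds hk (R := ‖α‖ + r) (half_pos hε)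
  refine .of_isLittleO ?_
  rw [Asymptotics.isLittleO_iff]
  intro c hc
  have hδ : 0 < min r (c / (2 * (C + 1))) := by positivity
  filter_upwards [Metric.ball_mem_nhds (α, α) hδ] with p hp
  rw [← ball_prod_same, mem_prod, mem_ball_iff_norm, mem_ball_iff_norm] at hp
  have h1 := hp.1.trans_le (min_le_left _ _)
  have h2 := hp.2.trans_le (min_le_left _ _)
  have h3 := hp.1.trans_le (min_le_right _ _)
  have h4 := hp.2.trans_le (min_le_right _ _)
  refine (htay α (hsub (Metric.mem_closedBall_self hr0.le)) p.1
    (hsub (mem_closedBall_iff_norm.2 h1.le)) p.2 (hsub (mem_closedBall_iff_norm.2 h2.le))).trans ?_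
  gcongr
  rw [lt_div_iff₀ (by positivity)] at h3 h4
  nlinarith [norm_nonneg (p.1 - α), norm_nonneg (p.2 - α)]

/-- Unlike the slab estimates this one is uniform over the whole cone, which is what the far regime
needs. -/
theorem norm_wMoment_sub_le (hk : S.IsKernel k B) {α β : EuclideanSpace ℝ (Fin (N + 1))}
    (hα : α ∈ S.negCone) (hβ : β ∈ S.negCone) :
    ‖S.wMoment k β - S.wMoment k α‖ ≤ B * ∫ v, |S.ansatz β v - S.ansatz α v| ∂S.μ := by
  rw [wMoment, wMoment, ← integral_sub (hS.integrable_ansatz_smul hk hβ)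
    (hS.integrable_ansatz_smul hk hα), ← integral_const_mul]
  refine norm_integral_le_of_norm_le
    ((((hS.integrable_ansatz hβ).sub (hS.integrable_ansatz hα)).abs).const_mul B) ?_
  filter_upwards [hk.bound] with v hv
  rw [← sub_smul, norm_smul, mul_comm, Real.norm_eq_abs]
  exact mul_le_mul_of_nonneg_right hv (abs_nonneg _)

/-- The Gram matrix of the basis functions is positive definite by linear independence modulo null
sets; its quadratic form attains a positive minimum on the unit sphere. -/
theorem exists_gram_lower : ∃ l > 0, ∀ ξ : EuclideanSpace ℝ (Fin (N + 1)),
    l * ‖ξ‖ ^ 2 ≤ ∫ v, inner ℝ ξ (S.m v) ^ 2 ∂S.μ := by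
  have := hS.isFiniteMeasure
  set Γ := S.kernelOp (fun _ => 1) S.m with hΓ
  have hΓi : ∀ ξ, inner ℝ ξ (Γ ξ) = ∫ v, inner ℝ ξ (S.m v) ^ 2 ∂S.μ := by
    intro ξ
    have hint : Integrable (fun v => inner ℝ ξ (S.m v) • S.m v) S.μ :=
      integrable_smul_kernel hS.isKernel_m
        (hS.integrable_of_bounded (hS.aemeas_inner ξ) (hS.abs_inner_le ξ))
    rw [hΓ, hS.kernelOp_apply hS.isKernel_m (integrable_const _)]
    simp only [one_mul]
    rw [← integral_inner hint]
    simp only [real_inner_smul_right, sq]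
  have hpos : ∀ ξ, ξ ≠ 0 → 0 < inner ℝ ξ (Γ ξ) := by
    intro ξ hξ
    rw [hΓi]
    have hi : Integrable (fun v => inner ℝ ξ (S.m v) ^ 2) S.μ := by
      refine hS.integrable_of_bounded ((hS.aemeas_inner ξ).pow 2)
        (C := (‖ξ‖ * ((N : ℝ) + 1)) ^ 2) ?_
      filter_upwards [hS.abs_inner_le ξ] with v hv
      rw [norm_pow, Real.norm_eq_abs]
      gcongr
    refine (integral_nonneg fun v => sq_nonneg _).lt_of_ne fun h0 => hξ ?_
    have := (integral_eq_zero_iff_of_nonneg (fun v => sq_nonneg _) hi).1 h0.symm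
    refine hS.basis.independent ξ ?_
    filter_upwards [this] with v hv
    simpa using hv
  obtain ⟨x, hx, hmin⟩ := (isCompact_sphere (0 : EuclideanSpace ℝ (Fin (N + 1))) 1).exists_isMinOn
    (NormedSpace.sphere_nonempty.2 zero_le_one)
    (f := fun ξ => inner ℝ ξ (Γ ξ)) (by fun_prop)
  have hx0 : x ≠ 0 := by
    rintro rfl
    simp at hx
  refine ⟨_, hpos x hx0, fun ξ => ?_⟩
  rw [← hΓi]
  rcases eq_or_ne ξ 0 with rfl | hξ
  · simp
  have hn : ‖ξ‖ ≠ 0 := norm_ne_zero_iff.2 hξ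
  have := hmin (a := ‖ξ‖⁻¹ • ξ) (by simp [norm_smul, hn])
  simp only [map_smul, real_inner_smul_left, real_inner_smul_right, mem_ofPred_eq] at this
  calc _ ≤ (‖ξ‖⁻¹ * (‖ξ‖⁻¹ * inner ℝ ξ (Γ ξ))) * ‖ξ‖ ^ 2 := by gcongr
    _ = _ := by field_simp

end Regular
end MomentSystem

/-! ### The map `û + γ id`: monotonicity, coercivity and local inversion. -/

namespace MomentSystem

variable {d N : ℕ} {S : MomentSystem d N}

/-- The map `α ↦ û(α) + γ α`, the inverse of `α̂_γ`. -/
def regMap (S : MomentSystem d N) (γ : ℝ) (α : EuclideanSpace ℝ (Fin (N + 1))) :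
    EuclideanSpace ℝ (Fin (N + 1)) :=
  S.uHat α + γ • α

/-- The derivative of `regMap`. -/
def regDeriv (S : MomentSystem d N) (γ : ℝ) (α : EuclideanSpace ℝ (Fin (N + 1))) :
    EuclideanSpace ℝ (Fin (N + 1)) →L[ℝ] EuclideanSpace ℝ (Fin (N + 1)) :=
  S.wDeriv S.m α + γ • ContinuousLinearMap.id ℝ _

/-- The relative entropy of the ansatz functions `G_β` and `G_α`. -/
def bregmanInt (S : MomentSystem d N) (β α : EuclideanSpace ℝ (Fin (N + 1))) : ℝ :=
  ∫ v, IsSublinearEntropy.bregman S.η (inner ℝ β (S.m v)) (inner ℝ α (S.m v)) ∂S.μ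

theorem neg_of_mem_negCone {α : EuclideanSpace ℝ (Fin (N + 1))} (hα : α ∈ S.negCone) :
    ∀ᵐ v ∂S.μ, inner ℝ α (S.m v) < 0 := by
  obtain ⟨ε, hε, h⟩ := hα
  filter_upwards [h] with v hv
  linarith

theorem uHat_eq_wMoment : S.uHat = S.wMoment S.m := rfl

namespace Regular

variable (hS : S.Regular)
include hS

theorem aemeas_legendreDual (α : EuclideanSpace ℝ (Fin (N + 1))) :
    AEStronglyMeasurable (fun v => legendreDual S.η (inner ℝ α (S.m v))) S.μ :=
  (hS.entropy.measurable_legendreDual.comp_aemeasurable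
    (hS.aemeas_inner α).aemeasurable).aestronglyMeasurable

theorem negCone_subset_dualDomain : S.negCone ⊆ S.dualDomain := by
  intro α hα
  refine ⟨?_, ?_⟩
  · filter_upwards [neg_of_mem_negCone hα] with v hv
    rw [hS.entropy.dom_dual]
    exact hv
  · obtain ⟨ε, hε, h⟩ := mem_slab_of_negCone hα
    obtain ⟨c, C, hb⟩ := hS.exists_bounds hε (R := ‖α‖)
    refine hS.integrable_of_bounded (hS.aemeas_legendreDual α) (C := C) ?_
    filter_upwards [hS.slab_mem_Icc h] with v hv
    exact hb.legendre_le _ hv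

theorem neg_of_mem_dualDomain {α : EuclideanSpace ℝ (Fin (N + 1))} (hα : α ∈ S.dualDomain) :
    ∀ᵐ v ∂S.μ, inner ℝ α (S.m v) < 0 := by
  filter_upwards [hα.1] with v hv
  rw [hS.entropy.dom_dual] at hv
  exact hv

theorem integrable_ansatz_mul_inner {α : EuclideanSpace ℝ (Fin (N + 1))} (hα : α ∈ S.negCone)
    (ξ : EuclideanSpace ℝ (Fin (N + 1))) :
    Integrable (fun v => S.ansatz α v * inner ℝ ξ (S.m v)) S.μ :=
  (hS.integrable_ansatz hα).mul_bdd (hS.aemeas_inner ξ) (hS.abs_inner_le ξ)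

theorem inner_uHat {α : EuclideanSpace ℝ (Fin (N + 1))} (hα : α ∈ S.negCone)
    (ξ : EuclideanSpace ℝ (Fin (N + 1))) :
    inner ℝ ξ (S.uHat α) = ∫ v, S.ansatz α v * inner ℝ ξ (S.m v) ∂S.μ := by
  rw [uHat, moment, ← integral_inner (hS.integrable_ansatz_smul hS.isKernel_m hα)]
  simp only [real_inner_smul_right]

theorem integrable_bregman {α β : EuclideanSpace ℝ (Fin (N + 1))} (hβ : β ∈ S.negCone)
    (hα : α ∈ S.dualDomain) : Integrable (fun v =>
      IsSublinearEntropy.bregman S.η (inner ℝ β (S.m v)) (inner ℝ α (S.m v))) S.μ := by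
  have h := (hα.2.sub (hS.negCone_subset_dualDomain hβ).2).sub
    (hS.integrable_ansatz_mul_inner hβ (α - β))
  refine h.congr (Eventually.of_forall fun v => ?_)
  simp only [IsSublinearEntropy.bregman, inner_sub_left, Pi.sub_apply, ansatz]

theorem bregmanInt_eq {α β : EuclideanSpace ℝ (Fin (N + 1))} (hβ : β ∈ S.negCone)
    (hα : α ∈ S.dualDomain) : S.bregmanInt β α =
      (∫ v, legendreDual S.η (inner ℝ α (S.m v)) ∂S.μ) -
      (∫ v, legendreDual S.η (inner ℝ β (S.m v)) ∂S.μ) - inner ℝ (α - β) (S.uHat β) := by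
  rw [hS.inner_uHat hβ, ← integral_sub hα.2 (hS.negCone_subset_dualDomain hβ).2, ← integral_sub _
    (hS.integrable_ansatz_mul_inner hβ (α - β))]
  swap
  · exact hα.2.sub (hS.negCone_subset_dualDomain hβ).2
  refine integral_congr_ae (Eventually.of_forall fun v => ?_)
  simp only [IsSublinearEntropy.bregman, inner_sub_left, ansatz]

theorem bregmanInt_nonneg {α β : EuclideanSpace ℝ (Fin (N + 1))} (hβ : β ∈ S.negCone)
    (hα : α ∈ S.dualDomain) : 0 ≤ S.bregmanInt β α := by
  refine integral_nonneg_of_ae ?_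
  filter_upwards [neg_of_mem_negCone hβ, hS.neg_of_mem_dualDomain hα] with v h1 h2
  exact hS.entropy.bregman_nonneg h1 h2

/-- Strict convexity forces `β ⬝ m = α ⬝ m` almost everywhere, and the basis is independent. -/
theorem eq_of_bregmanInt_eq_zero {α β : EuclideanSpace ℝ (Fin (N + 1))} (hβ : β ∈ S.negCone)
    (hα : α ∈ S.dualDomain) (h0 : S.bregmanInt β α = 0) : β = α := by
  have hnn : 0 ≤ᵐ[S.μ] fun v =>
      IsSublinearEntropy.bregman S.η (inner ℝ β (S.m v)) (inner ℝ α (S.m v)) := by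
    filter_upwards [neg_of_mem_negCone hβ, hS.neg_of_mem_dualDomain hα] with v h1 h2
    exact hS.entropy.bregman_nonneg h1 h2
  have hz := (integral_eq_zero_iff_of_nonneg_ae hnn (hS.integrable_bregman hβ hα)).1 h0
  refine sub_eq_zero.1 (hS.basis.independent _ ?_)
  filter_upwards [hz, neg_of_mem_negCone hβ, hS.neg_of_mem_dualDomain hα] with v h1 h2 h3
  rw [inner_sub_left, sub_eq_zero]
  by_contra hne
  exact (hS.entropy.bregman_pos h2 h3 hne).ne' h1

/-- At its stationary point `β` the concave objective differs from its value at `α` by the convexity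
gap alone. Maximality and uniqueness follow at once, for `γ = 0` too, and the same identity later
evaluates the relative entropy. -/
theorem dualObjective_sub {γ : ℝ} {α β : EuclideanSpace ℝ (Fin (N + 1))} (hβ : β ∈ S.negCone)
    (hα : α ∈ S.dualDomain) :
    S.dualObjective γ (S.regMap γ β) β - S.dualObjective γ (S.regMap γ β) α =
      S.bregmanInt β α + γ / 2 * ‖β - α‖ ^ 2 := by
  rw [hS.bregmanInt_eq hβ hα]
  simp only [dualObjective, regMap, inner_add_right, inner_sub_left, real_inner_smul_right,
    norm_sub_sq_real, real_inner_self_eq_norm_sq, real_inner_comm α β]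
  ring

theorem isDualSolution_iff {γ : ℝ} (hγ : 0 ≤ γ) {α : EuclideanSpace ℝ (Fin (N + 1))}
    (hα : α ∈ S.negCone) (β : EuclideanSpace ℝ (Fin (N + 1))) :
    S.IsDualSolution γ (S.regMap γ α) β ↔ β = α := by
  have hα' := hS.negCone_subset_dualDomain hα
  constructor
  · rintro ⟨hβ, hmax⟩
    have h1 := hmax α hα'
    have h2 := hS.dualObjective_sub (γ := γ) hα hβ
    have h3 := hS.bregmanInt_nonneg hα hβ
    have h4 : 0 ≤ γ / 2 * ‖α - β‖ ^ 2 := by positivity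
    exact (hS.eq_of_bregmanInt_eq_zero hα hβ (by linarith)).symm
  · rintro rfl
    refine ⟨hα', fun α hα'' => ?_⟩
    have h2 := hS.dualObjective_sub (γ := γ) hα hα''
    have h3 := hS.bregmanInt_nonneg hα hα''
    have h4 : 0 ≤ γ / 2 * ‖β - α‖ ^ 2 := by positivity
    linarith

theorem alphaHat_regMap {γ : ℝ} (hγ : 0 ≤ γ) {α : EuclideanSpace ℝ (Fin (N + 1))}
    (hα : α ∈ S.negCone) : S.alphaHat γ (S.regMap γ α) = α := by
  rw [← hS.isDualSolution_iff hγ hα]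
  exact Classical.epsilon_spec ⟨α, (hS.isDualSolution_iff hγ hα α).2 rfl⟩

theorem hasStrictFDerivAt_regMap (γ : ℝ) {α : EuclideanSpace ℝ (Fin (N + 1))}
    (hα : α ∈ S.negCone) : HasStrictFDerivAt (S.regMap γ) (S.regDeriv γ α) α :=
  (hS.hasStrictFDerivAt_wMoment hS.isKernel_m hα).add ((hasStrictFDerivAt_id α).const_smul γ)

/-- Coercivity of the derivative, strong monotonicity of `û` and convexity of the relative entropy,
with constants uniform over a slab. -/
theorem exists_coercive {R ε : ℝ} (hε : 0 < ε) : ∃ l > 0,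
    (∀ α ∈ S.slab R ε, ∀ ξ, l * ‖ξ‖ ^ 2 ≤ inner ℝ ξ (S.wDeriv S.m α ξ)) ∧
    (∀ α ∈ S.slab R ε, ∀ β ∈ S.slab R ε,
      l * ‖α - β‖ ^ 2 ≤ inner ℝ (α - β) (S.uHat α - S.uHat β)) ∧
    (∀ α ∈ S.slab R ε, ∀ β ∈ S.slab R ε, l * ‖β - α‖ ^ 2 ≤ S.bregmanInt β α) := by
  obtain ⟨l, hl, hgram⟩ := hS.exists_gram_lower
  obtain ⟨c, C, hb⟩ := hS.exists_bounds hε (R := R)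
  have hc := hb.pos
  have hneg : ∀ α ∈ S.slab R ε, α ∈ S.negCone := fun α hα => mem_negCone_of_slab hε hα
  have hsq : ∀ ξ, Integrable (fun v => inner ℝ ξ (S.m v) ^ 2) S.μ := by
    intro ξ
    refine hS.integrable_of_bounded ((hS.aemeas_inner ξ).pow 2)
      (C := (‖ξ‖ * ((N : ℝ) + 1)) ^ 2) ?_
    filter_upwards [hS.abs_inner_le ξ] with v hv
    rw [norm_pow, Real.norm_eq_abs]
    gcongr
  -- `c / 4` is the weakest of the three pointwise constants, the one for the Bregman distance.
  have key : ∀ ξ, ∀ f : EuclideanSpace ℝ (Fin d) → ℝ, Integrable f S.μ →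
      (∀ᵐ v ∂S.μ, c / 4 * inner ℝ ξ (S.m v) ^ 2 ≤ f v) → c / 4 * l * ‖ξ‖ ^ 2 ≤ ∫ v, f v ∂S.μ := by
    intro ξ f hf hle
    calc c / 4 * l * ‖ξ‖ ^ 2 = c / 4 * (l * ‖ξ‖ ^ 2) := by ring
      _ ≤ c / 4 * ∫ v, inner ℝ ξ (S.m v) ^ 2 ∂S.μ := by gcongr; exact hgram ξ
      _ = ∫ v, c / 4 * inner ℝ ξ (S.m v) ^ 2 ∂S.μ := (integral_const_mul _ _).symm
      _ ≤ _ := integral_mono_ae ((hsq ξ).const_mul _) hf hle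
  refine ⟨c / 4 * l, by positivity, fun α hα ξ => ?_, fun α hα β hβ => ?_, fun α hα β hβ => ?_⟩
  · have hi1 : Integrable (fun v => deriv (deriv (legendreDual S.η)) (inner ℝ α (S.m v)) *
        inner ℝ ξ (S.m v)) S.μ :=
      (hS.integrable_ansatz_deriv (hneg α hα)).mul_bdd (hS.aemeas_inner ξ)
        (hS.abs_inner_le ξ)
    have hi2 := hi1.mul_bdd (hS.aemeas_inner ξ) (hS.abs_inner_le ξ)
    rw [wDeriv, hS.kernelOp_apply hS.isKernel_m (hS.integrable_ansatz_deriv (hneg α hα)),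
      ← integral_inner (integrable_smul_kernel hS.isKernel_m hi1)]
    simp only [real_inner_smul_right]
    refine key ξ _ hi2 ?_
    filter_upwards [hS.slab_mem_Icc hα] with v hv
    have := hb.le_deriv _ hv
    nlinarith [sq_nonneg (inner ℝ ξ (S.m v))]
  · have hi := (hS.integrable_ansatz_mul_inner (hneg α hα) (α - β)).sub
      (hS.integrable_ansatz_mul_inner (hneg β hβ) (α - β))
    rw [inner_sub_right, hS.inner_uHat (hneg α hα), hS.inner_uHat (hneg β hβ), ← integral_sub
      (hS.integrable_ansatz_mul_inner (hneg α hα) (α - β))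
      (hS.integrable_ansatz_mul_inner (hneg β hβ) (α - β))]
    refine key _ _ hi ?_
    filter_upwards [hS.slab_mem_Icc hα, hS.slab_mem_Icc hβ] with v h1 h2
    have := hb.strong_mono _ h1 _ h2
    rw [← sub_mul, inner_sub_left]
    refine le_trans ?_ this
    nlinarith [sq_nonneg (inner ℝ α (S.m v) - inner ℝ β (S.m v))]
  · refine key _ _ (hS.integrable_bregman (hneg β hβ)
      (hS.negCone_subset_dualDomain (hneg α hα))) ?_
    filter_upwards [hS.slab_mem_Icc hα, hS.slab_mem_Icc hβ] with v h1 h2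
    rw [inner_sub_left]
    exact hb.bregman_ge hS.entropy hε h2 h1

/-- Strong monotonicity and convexity on a ball extend to all of the domain. -/
theorem coercive_of_closedBall {R ε r l : ℝ} (hε : 0 < ε) (hr : 0 < r) (hl : 0 < l)
    {α β : EuclideanSpace ℝ (Fin (N + 1))} (hball : Metric.closedBall α r ⊆ S.slab R ε)
    (hmono : ∀ α ∈ S.slab R ε, ∀ β ∈ S.slab R ε,
      l * ‖α - β‖ ^ 2 ≤ inner ℝ (α - β) (S.uHat α - S.uHat β))
    (hconv : ∀ α ∈ S.slab R ε, ∀ β ∈ S.slab R ε, l * ‖β - α‖ ^ 2 ≤ S.bregmanInt β α)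
    (hβ : β ∈ S.negCone) :
    l * min r ‖β - α‖ * ‖β - α‖ ≤ inner ℝ (β - α) (S.uHat β - S.uHat α) ∧
      l * min r ‖β - α‖ ^ 2 ≤ S.bregmanInt β α := by
  have hα : α ∈ S.slab R ε := hball (Metric.mem_closedBall_self hr.le)
  have hαn := mem_negCone_of_slab hε hα
  rcases le_or_gt ‖β - α‖ r with hle | hgt
  · have hβ' := hball (mem_closedBall_iff_norm.2 hle)
    rw [min_eq_right hle]
    exact ⟨by have := hmono _ hβ' _ hα; linarith, hconv _ hα _ hβ'⟩
  have hX : 0 < ‖β - α‖ := hr.trans hgt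
  rw [min_eq_left hgt.le]
  -- `x` is the point where the segment from `α` to `β` leaves the ball. The quadratic bounds hold
  -- at `x`, and the quantities only grow from `x` to `β`.
  set t := r / ‖β - α‖ with ht
  have ht0 : 0 < t := by positivity
  have ht1 : t ≤ 1 := (div_le_one hX).2 hgt.le
  set x := α + t • (β - α) with hx
  have hxα : x - α = t • (β - α) := by rw [hx]; abel
  have hnx : ‖x - α‖ = r := by
    rw [hxα, norm_smul, Real.norm_of_nonneg ht0.le, ht, div_mul_cancel₀ _ hX.ne']
  have hxs := hball (mem_closedBall_iff_norm.2 hnx.le)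
  have hxn := mem_negCone_of_slab hε hxs
  have hxv : ∀ v, inner ℝ x (S.m v) =
      inner ℝ α (S.m v) + t * (inner ℝ β (S.m v) - inner ℝ α (S.m v)) := fun v => by
    rw [hx, inner_add_left, real_inner_smul_left, inner_sub_left]
  constructor
  · have h1 := hmono _ hxs _ hα
    rw [hnx, hxα, real_inner_smul_left] at h1
    have h2 : inner ℝ (β - α) (S.uHat x - S.uHat α) ≤
        inner ℝ (β - α) (S.uHat β - S.uHat α) := by
      rw [inner_sub_right, inner_sub_right, hS.inner_uHat hxn, hS.inner_uHat hβ,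
        hS.inner_uHat hαn, sub_le_sub_iff_right]
      refine integral_mono_ae (hS.integrable_ansatz_mul_inner hxn _)
        (hS.integrable_ansatz_mul_inner hβ _) ?_
      filter_upwards [neg_of_mem_negCone hβ, neg_of_mem_negCone hαn] with v h3 h4
      have := hS.entropy.dual_ray_le h3 h4 ht0.le ht1
      simp only [ansatz, hxv, inner_sub_left]
      linarith
    have h3 : t * (l * r * ‖β - α‖) = l * r ^ 2 := by
      rw [ht]; field_simp
    have h4 : t * (l * r * ‖β - α‖) ≤ t * inner ℝ (β - α) (S.uHat β - S.uHat α) := by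
      rw [h3]
      exact h1.trans (by gcongr)
    exact le_of_mul_le_mul_left h4 ht0
  · have h1 := hconv _ hα _ hxs
    rw [hnx] at h1
    refine h1.trans (integral_mono_ae
      (hS.integrable_bregman hxn (hS.negCone_subset_dualDomain hαn))
      (hS.integrable_bregman hβ (hS.negCone_subset_dualDomain hαn)) ?_)
    filter_upwards [neg_of_mem_negCone hβ, neg_of_mem_negCone hαn] with v h3 h4
    rw [hxv]
    exact hS.entropy.bregman_ray_le h3 h4 ht0.le ht1

/-- `û` is monotone. -/
theorem inner_uHat_sub_nonneg {α β : EuclideanSpace ℝ (Fin (N + 1))} (hα : α ∈ S.negCone)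
    (hβ : β ∈ S.negCone) : 0 ≤ inner ℝ (β - α) (S.uHat β - S.uHat α) := by
  rw [inner_sub_right, hS.inner_uHat hβ, hS.inner_uHat hα, ← integral_sub
    (hS.integrable_ansatz_mul_inner hβ _) (hS.integrable_ansatz_mul_inner hα _)]
  refine integral_nonneg_of_ae ?_
  filter_upwards [neg_of_mem_negCone hβ, neg_of_mem_negCone hα] with v h3 h4
  have := hS.entropy.dual_mono_mul_nonneg h3 h4
  simp only [ansatz, inner_sub_left, Pi.zero_apply]
  linarith

/-- Since `û` is monotone, `û + γ id` is strongly monotone with constant `γ`; thus `α̂_γ` is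
Lipschitz with constant `1/γ` for `γ > 0`. -/
theorem mul_norm_sub_le_regMap {γ : ℝ} {α β : EuclideanSpace ℝ (Fin (N + 1))}
    (hα : α ∈ S.negCone) (hβ : β ∈ S.negCone) :
    γ * ‖β - α‖ ≤ ‖S.regMap γ β - S.regMap γ α‖ := by
  rcases eq_or_ne β α with rfl | hne
  · simp
  have hX : 0 < ‖β - α‖ := norm_sub_pos_iff.2 hne
  have h1 := hS.inner_uHat_sub_nonneg hα hβ
  have h2 : inner ℝ (β - α) (S.regMap γ β - S.regMap γ α) =
      inner ℝ (β - α) (S.uHat β - S.uHat α) + γ * ‖β - α‖ ^ 2 := by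
    rw [← real_inner_self_eq_norm_sq, ← real_inner_smul_right, ← inner_add_right]
    congr 1
    simp only [regMap, smul_sub]
    abel
  have h3 := real_inner_le_norm (β - α) (S.regMap γ β - S.regMap γ α)
  refine le_of_mul_le_mul_left ?_ hX
  nlinarith

/-- Coercivity makes the derivative injective, hence invertible in finite dimension. The bound `l⁻¹`
uses only the part from `û`, so it does not degenerate as `γ → 0`. -/
theorem exists_regDeriv_inverse {γ l : ℝ} (hγ : 0 ≤ γ) (hl : 0 < l)
    {α : EuclideanSpace ℝ (Fin (N + 1))} (hα : α ∈ S.negCone)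
    (hco : ∀ ξ, l * ‖ξ‖ ^ 2 ≤ inner ℝ ξ (S.wDeriv S.m α ξ)) :
    ∃ e : EuclideanSpace ℝ (Fin (N + 1)) ≃L[ℝ] EuclideanSpace ℝ (Fin (N + 1)),
      (e : EuclideanSpace ℝ (Fin (N + 1)) →L[ℝ] EuclideanSpace ℝ (Fin (N + 1))) =
        S.regDeriv γ α ∧ (∀ ξ, ‖e.symm ξ‖ ≤ l⁻¹ * ‖ξ‖) ∧
      HasStrictFDerivAt (S.alphaHat γ)
        (e.symm : EuclideanSpace ℝ (Fin (N + 1)) →L[ℝ] EuclideanSpace ℝ (Fin (N + 1)))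
        (S.regMap γ α) := by
  have hlow : ∀ ξ, l * ‖ξ‖ ≤ ‖S.regDeriv γ α ξ‖ := by
    intro ξ
    rcases eq_or_ne ξ 0 with rfl | hne
    · simp
    have hX : 0 < ‖ξ‖ := norm_pos_iff.2 hne
    have h1 : inner ℝ ξ (S.regDeriv γ α ξ) =
        inner ℝ ξ (S.wDeriv S.m α ξ) + γ * ‖ξ‖ ^ 2 := by
      simp [regDeriv, inner_add_right, real_inner_smul_right]
    have h2 := real_inner_le_norm ξ (S.regDeriv γ α ξ)
    have h3 := hco ξ
    have h4 : 0 ≤ γ * ‖ξ‖ ^ 2 := by positivity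
    refine le_of_mul_le_mul_left ?_ hX
    nlinarith
  have hinj : Function.Injective (S.regDeriv γ α : EuclideanSpace ℝ (Fin (N + 1)) →ₗ[ℝ]
      EuclideanSpace ℝ (Fin (N + 1))) := by
    rw [← LinearMap.ker_eq_bot, LinearMap.ker_eq_bot']
    intro ξ hξ
    have h1 := hlow ξ
    rw [ContinuousLinearMap.coe_coe] at hξ
    rw [hξ, norm_zero] at h1
    exact norm_le_zero_iff.1 (by nlinarith [norm_nonneg ξ])
  set e := (LinearEquiv.ofInjectiveEndo _ hinj).toContinuousLinearEquiv with he
  have hcoe : (e : EuclideanSpace ℝ (Fin (N + 1)) →L[ℝ] EuclideanSpace ℝ (Fin (N + 1))) =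
      S.regDeriv γ α := by
    ext1 ξ
    rfl
  refine ⟨e, hcoe, fun ξ => ?_, ?_⟩
  · have h1 := hlow (e.symm ξ)
    rw [← hcoe, ContinuousLinearEquiv.coe_coe, e.apply_symm_apply] at h1
    rw [← div_eq_inv_mul, le_div_iff₀ hl]
    linarith
  · have h1 := hS.hasStrictFDerivAt_regMap γ hα
    rw [← hcoe] at h1
    refine h1.to_local_left_inverse ?_
    filter_upwards [hS.isOpen_negCone.mem_nhds hα] with x hx
    exact hS.alphaHat_regMap hγ hx

theorem map_nhds_regMap {γ : ℝ} (hγ : 0 ≤ γ) {α : EuclideanSpace ℝ (Fin (N + 1))}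
    (hα : α ∈ S.negCone) : map (S.regMap γ) (𝓝 α) = 𝓝 (S.regMap γ α) := by
  obtain ⟨ε, hε, h⟩ := mem_slab_of_negCone hα
  obtain ⟨l, hl, hco, -⟩ := hS.exists_coercive hε (R := ‖α‖)
  obtain ⟨e, he, -⟩ := hS.exists_regDeriv_inverse hγ hl hα (hco α h)
  have h1 := hS.hasStrictFDerivAt_regMap γ hα
  rw [← he] at h1
  exact h1.map_nhds_eq_of_equiv

end Regular
end MomentSystem

/-! ### Global solvability, the gradient of the regularized entropy, and the flux derivatives. -/

theorem EuclideanSpace.norm_le_sum_norm {ι : Type*} [Fintype ι] (x : EuclideanSpace ℝ ι) :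
    ‖x‖ ≤ ∑ i, |x i| := by
  rw [EuclideanSpace.norm_eq]
  refine Real.sqrt_le_iff.2 ⟨Finset.sum_nonneg fun i _ => abs_nonneg _, ?_⟩
  simpa only [Real.norm_eq_abs] using
    Finset.sum_sq_le_sq_sum_of_nonneg (s := Finset.univ) fun i _ => abs_nonneg (x i)

theorem HasFDerivAt.congr_of_eventually {E F : Type*} [NormedAddCommGroup E] [NormedSpace ℝ E]
    [NormedAddCommGroup F] [NormedSpace ℝ F] {f g : E → F} {L : E →L[ℝ] F} {x : E}
    (hg : HasFDerivAt g L x) (h : ∀ᶠ y in 𝓝 x, f y = g y) : HasFDerivAt f L x :=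
  hg.congr_of_eventuallyEq h

namespace MomentSystem

variable {d N : ℕ} {S : MomentSystem d N}

/-- The kernel `v m` of the flux. -/
def fluxKernel (S : MomentSystem d N) (v : EuclideanSpace ℝ (Fin d)) :
    EuclideanSpace ℝ (Fin d × Fin (N + 1)) :=
  WithLp.toLp 2 fun p => v p.1 * S.m v p.2

namespace Regular

variable (hS : S.Regular)
include hS

theorem inner_single_zero :
    ∀ᵐ v ∂S.μ, inner ℝ (EuclideanSpace.single (0 : Fin (N + 1)) (1 : ℝ)) (S.m v) = 1 := by
  refine ae_restrict_of_forall_mem hS.measurableSet fun v hv => ?_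
  rw [EuclideanSpace.inner_single_left, hS.basis.zero_eq_one v hv]
  simp

theorem negCone_nonempty : S.negCone.Nonempty := by
  refine ⟨-EuclideanSpace.single (0 : Fin (N + 1)) (1 : ℝ), 1, one_pos, ?_⟩
  filter_upwards [hS.inner_single_zero] with v hv
  rw [inner_neg_left, hv]

/-- A limit of multiplier vectors in the cone stays in it if the masses of the ansatz functions
converge. -/
theorem mem_negCone_of_tendsto (hN : S.NoConcentration)
    {β : ℕ → EuclideanSpace ℝ (Fin (N + 1))} {b : EuclideanSpace ℝ (Fin (N + 1))}
    (hβ : ∀ n, β n ∈ S.negCone) (hb : Tendsto β atTop (𝓝 b)) {c : ℝ}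
    (hc : Tendsto (fun n => ∫ v, S.ansatz (β n) v ∂S.μ) atTop (𝓝 c)) : b ∈ S.negCone := by
  have hmeas : ∀ n, AEMeasurable (fun v => ENNReal.ofReal (S.ansatz (β n) v)) S.μ := fun n =>
    (hS.aemeas_ansatz (β n)).aemeasurable.ennreal_ofReal
  -- By Fatou the limit inferior of the ansatz functions has finite integral. It is infinite where
  -- `b ⬝ m = 0`, so that set is null; elsewhere it equals `G_b`, which is therefore integrable, and
  -- no concentration applies.
  have hfatou := lintegral_liminf_le' (μ := S.μ) (u := atTop) hmeas
  have hlim : liminf (fun n => ∫⁻ v, ENNReal.ofReal (S.ansatz (β n) v) ∂S.μ) atTop =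
      ENNReal.ofReal c := by
    refine Tendsto.liminf_eq ?_
    refine ((ENNReal.continuous_ofReal.tendsto c).comp hc).congr fun n => ?_
    exact ofReal_integral_eq_lintegral_ofReal (hS.ansatz_mem_densities (hβ n)).1
      ((hS.ansatz_mem_densities (hβ n)).2.mono fun v hv => hv.le)
  rw [hlim] at hfatou
  have hfin := hfatou.trans_lt ENNReal.ofReal_lt_top
  have hneg : ∀ᵐ v ∂S.μ, ∀ n, inner ℝ (β n) (S.m v) < 0 :=
    ae_all_iff.2 fun n => neg_of_mem_negCone (hβ n)
  have htend : ∀ v, Tendsto (fun n => inner ℝ (β n) (S.m v)) atTop (𝓝 (inner ℝ b (S.m v))) :=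
    fun v => hb.inner tendsto_const_nhds
  have htop : ∀ v, (∀ n, inner ℝ (β n) (S.m v) < 0) → inner ℝ b (S.m v) = 0 →
      Tendsto (fun n => ENNReal.ofReal (S.ansatz (β n) v)) atTop (𝓝 ⊤) := fun v h1 h0 =>
    ENNReal.tendsto_ofReal_atTop.comp (hS.entropy.dual_tendsto.comp
      (tendsto_nhdsWithin_iff.2 ⟨h0 ▸ htend v, Eventually.of_forall h1⟩))
  have hreg : ∀ v, inner ℝ b (S.m v) < 0 →
      Tendsto (fun n => ENNReal.ofReal (S.ansatz (β n) v)) atTop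
        (𝓝 (ENNReal.ofReal (S.ansatz b v))) := fun v hv =>
    (ENNReal.continuous_ofReal.tendsto _).comp
      ((hS.entropy.hasDerivAt_dual hv).continuousAt.tendsto.comp (htend v))
  have hlimmeas : AEMeasurable
      (fun v => liminf (fun n => ENNReal.ofReal (S.ansatz (β n) v)) atTop) S.μ := by
    refine aemeasurable_of_tendsto_metrizable_ae atTop hmeas ?_
    filter_upwards [hneg] with v h1
    rcases (le_of_tendsto' (htend v) fun n => (h1 n).le).lt_or_eq with h0 | h0
    · rw [(hreg v h0).liminf_eq]
      exact hreg v h0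
    · rw [(htop v h1 h0).liminf_eq]
      exact htop v h1 h0
  have hbneg : ∀ᵐ v ∂S.μ, inner ℝ b (S.m v) < 0 := by
    filter_upwards [hneg, ae_lt_top' hlimmeas hfin.ne] with v h1 h2
    exact (le_of_tendsto' (htend v) fun n => (h1 n).le).lt_of_ne fun h0 =>
      h2.ne (htop v h1 h0).liminf_eq
  refine hN b hbneg ⟨hS.aemeas_ansatz b, ?_⟩
  rw [hasFiniteIntegral_iff_ofReal]
  · refine lt_of_le_of_lt (lintegral_mono_ae ?_) hfin
    filter_upwards [hbneg] with v hv
    exact (hreg v hv).liminf_eq.ge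
  · filter_upwards [hbneg] with v hv using (hS.entropy.dual_pos hv).le

/-- The image is nonempty, open and closed in a connected space. This yields existence of maximizers
for every `w` without a direct coercivity argument. -/
theorem regMap_image (hN : S.NoConcentration) {γ : ℝ} (hγ : 0 < γ) :
    S.regMap γ '' S.negCone = univ := by
  refine IsClopen.eq_univ ⟨?_, ?_⟩ (hS.negCone_nonempty.image _)
  · refine IsSeqClosed.isClosed fun x w hx hw => ?_
    choose β hβ hβx using hx
    have hcau : CauchySeq β := by
      rw [Metric.cauchySeq_iff]
      intro δ hδ
      obtain ⟨n₀, hn₀⟩ := Metric.cauchySeq_iff.1 hw.cauchySeq (γ * δ) (by positivity)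
      refine ⟨n₀, fun n hn k hk => ?_⟩
      have h1 := hn₀ n hn k hk
      rw [dist_eq_norm, ← hβx n, ← hβx k] at h1
      rw [dist_eq_norm]
      have h2 := (hS.mul_norm_sub_le_regMap (γ := γ) (hβ k) (hβ n)).trans_lt h1
      exact lt_of_mul_lt_mul_left h2 hγ.le
    obtain ⟨b, hb⟩ := cauchySeq_tendsto_of_complete hcau
    -- As `m_0 = 1`, pairing `û(β n) = x n - γ β n` with the first unit vector gives the mass of the
    -- ansatz, so the masses converge.
    have hbn : b ∈ S.negCone := by
      refine hS.mem_negCone_of_tendsto hN hβ hb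
        (c := inner ℝ (EuclideanSpace.single (0 : Fin (N + 1)) (1 : ℝ)) (w - γ • b)) ?_
      refine ((continuous_const.inner continuous_id).tendsto (w - γ • b)).comp
        (hw.sub (hb.const_smul γ)) |>.congr fun n => ?_
      have h1 : x n - γ • β n = S.uHat (β n) := by rw [← hβx n, regMap]; abel
      simp only [Function.comp_apply, id_eq, h1]
      rw [hS.inner_uHat (hβ n)]
      refine integral_congr_ae ?_
      filter_upwards [hS.inner_single_zero] with v hv
      rw [hv, mul_one]
    refine ⟨b, hbn, tendsto_nhds_unique ?_ hw⟩
    exact ((hS.hasStrictFDerivAt_regMap γ hbn).continuousAt.tendsto.comp hb).congr hβx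
  · rw [isOpen_iff_mem_nhds]
    rintro _ ⟨α, hα, rfl⟩
    rw [← hS.map_nhds_regMap hγ.le hα]
    exact image_mem_map (hS.isOpen_negCone.mem_nhds hα)

theorem alphaHat_spec (hN : S.NoConcentration) {γ : ℝ} (hγ : 0 < γ)
    (w : EuclideanSpace ℝ (Fin (N + 1))) :
    S.alphaHat γ w ∈ S.negCone ∧ S.regMap γ (S.alphaHat γ w) = w := by
  obtain ⟨α, hα, rfl⟩ : w ∈ S.regMap γ '' S.negCone := hS.regMap_image hN hγ ▸ mem_univ w
  rw [hS.alphaHat_regMap hγ.le hα]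
  exact ⟨hα, rfl⟩

theorem alphaHat_uHat {α : EuclideanSpace ℝ (Fin (N + 1))} (hα : α ∈ S.negCone) :
    S.alphaHat 0 (S.uHat α) = α := by
  have := hS.alphaHat_regMap le_rfl hα
  rwa [regMap, zero_smul, add_zero] at this

/-- Absence of a duality gap: `η(G) = y G - η_*(y)` at `y = α ⬝ m`, and the moment residual is `-γ
α`, so the penalty equals `γ/2 ‖α‖²`. -/
theorem entropy_eq (hN : S.NoConcentration) {γ : ℝ} (hγ : 0 < γ)
    (w : EuclideanSpace ℝ (Fin (N + 1))) :
    S.entropy γ w = S.dualObjective γ w (S.alphaHat γ w) := by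
  obtain ⟨hα, hw⟩ := hS.alphaHat_spec hN hγ w
  set α := S.alphaHat γ w with hαd
  have h1 : ∫ v, S.η (S.ansatz α v) ∂S.μ =
      inner ℝ α (S.uHat α) - ∫ v, legendreDual S.η (inner ℝ α (S.m v)) ∂S.μ := by
    rw [hS.inner_uHat hα, ← integral_sub (hS.integrable_ansatz_mul_inner hα α)
      (hS.negCone_subset_dualDomain hα).2]
    refine integral_congr_ae ?_
    filter_upwards [neg_of_mem_negCone hα] with v hv
    rw [ansatz, hS.entropy.entropy_dual hv]
    ring
  have h2 : S.moment (S.ansatz α) - w = -(γ • α) := by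
    rw [← hw, regMap, uHat]; abel
  rw [MomentSystem.entropy, ← hαd, h1, h2, norm_neg, norm_smul, Real.norm_of_nonneg hγ.le, dualObjective]
  have h3 : inner ℝ α w = inner ℝ α (S.uHat α) + γ * ‖α‖ ^ 2 := by
    conv_lhs => rw [← hw, regMap, inner_add_right, real_inner_smul_right,
      real_inner_self_eq_norm_sq]
  rw [h3]
  field_simp
  ring

/-- With the entropy written as an optimal dual value, the relative entropy is the objective gap at
`w` between the multipliers of `w` and `u`. -/
theorem relEntropy_eq (hN : S.NoConcentration) {γ : ℝ} (hγ : 0 < γ)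
    (w u : EuclideanSpace ℝ (Fin (N + 1))) :
    S.relEntropy γ w u = S.bregmanInt (S.alphaHat γ w) (S.alphaHat γ u) +
      γ / 2 * ‖S.alphaHat γ w - S.alphaHat γ u‖ ^ 2 := by
  obtain ⟨hβ, hw⟩ := hS.alphaHat_spec hN hγ w
  obtain ⟨hα, hu⟩ := hS.alphaHat_spec hN hγ u
  rw [← hS.dualObjective_sub hβ (hS.negCone_subset_dualDomain hα), hw, relEntropy,
    hS.entropy_eq hN hγ, hS.entropy_eq hN hγ, dualObjective, dualObjective, dualObjective,
    inner_sub_right]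
  ring

theorem relEntropy_nonneg (hN : S.NoConcentration) {γ : ℝ} (hγ : 0 < γ)
    (w u : EuclideanSpace ℝ (Fin (N + 1))) : 0 ≤ S.relEntropy γ w u := by
  rw [hS.relEntropy_eq hN hγ]
  have := hS.bregmanInt_nonneg (hS.alphaHat_spec hN hγ w).1
    (hS.negCone_subset_dualDomain (hS.alphaHat_spec hN hγ u).1)
  positivity

/-- The symmetrized relative entropy is `(α̂_γ(w) - α̂_γ(u)) ⬝ (w - u)`, at most `‖w - u‖² / γ` by
the Lipschitz bound. Both summands are nonnegative, so each is `O(‖w - u‖²)`. -/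
theorem hasGradientAt_entropy (hN : S.NoConcentration) {γ : ℝ} (hγ : 0 < γ)
    (u : EuclideanSpace ℝ (Fin (N + 1))) :
    HasGradientAt (S.entropy γ) (S.alphaHat γ u) u := by
  have hup : ∀ w, S.relEntropy γ w u ≤ γ⁻¹ * ‖w - u‖ ^ 2 := by
    intro w
    obtain ⟨hβ, hw⟩ := hS.alphaHat_spec hN hγ w
    obtain ⟨hα, hu⟩ := hS.alphaHat_spec hN hγ u
    have h1 : S.relEntropy γ w u + S.relEntropy γ u w =
        inner ℝ (S.alphaHat γ w - S.alphaHat γ u) (w - u) := by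
      simp only [relEntropy, inner_sub_left, inner_sub_right]
      ring
    have h2 := real_inner_le_norm (S.alphaHat γ w - S.alphaHat γ u) (w - u)
    have h3 := hS.mul_norm_sub_le_regMap (γ := γ) hα hβ
    rw [hw, hu] at h3
    have h4 : ‖S.alphaHat γ w - S.alphaHat γ u‖ ≤ γ⁻¹ * ‖w - u‖ := by
      rwa [← div_eq_inv_mul, le_div_iff₀ hγ, mul_comm]
    have h5 := hS.relEntropy_nonneg hN hγ u w
    nlinarith [norm_nonneg (w - u)]
  rw [hasGradientAt_iff_isLittleO, Asymptotics.isLittleO_iff]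
  intro c hc
  filter_upwards [Metric.ball_mem_nhds u (ε := γ * c) (by positivity)] with w hw
  have h1 : S.entropy γ w - S.entropy γ u - inner ℝ (S.alphaHat γ u) (w - u) =
    S.relEntropy γ w u := rfl
  rw [h1, Real.norm_of_nonneg (hS.relEntropy_nonneg hN hγ w u)]
  refine (hup w).trans ?_
  rw [mem_ball_iff_norm] at hw
  calc γ⁻¹ * ‖w - u‖ ^ 2 = (γ⁻¹ * ‖w - u‖) * ‖w - u‖ := by ring
    _ ≤ c * ‖w - u‖ := by
      gcongr
      rw [← div_eq_inv_mul, div_le_iff₀ hγ]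
      linarith

theorem gradient_entropy (hN : S.NoConcentration) {γ : ℝ} (hγ : 0 < γ) :
    gradient (S.entropy γ) = S.alphaHat γ :=
  funext fun u => (hS.hasGradientAt_entropy hN hγ u).gradient

theorem exists_isKernel_fluxKernel : ∃ B, S.IsKernel S.fluxKernel B := by
  obtain ⟨R, hR⟩ := hS.isBounded.exists_norm_le
  refine ⟨∑ _p : Fin d × Fin (N + 1), max R 0, ?_, by positivity, ?_⟩
  · refine (PiLp.continuous_toLp 2 _).comp_aestronglyMeasurable
      (aemeasurable_pi_iff.2 fun p => ?_).aestronglyMeasurable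
    refine AEMeasurable.mul ?_ ?_
    · exact (by fun_prop : Continuous fun v : EuclideanSpace ℝ (Fin d) => v p.1).measurable.aemeasurable
    · exact ((by fun_prop : Continuous fun x : EuclideanSpace ℝ (Fin (N + 1)) =>
        x p.2).comp_aestronglyMeasurable hS.basis.aestronglyMeasurable).aemeasurable
  · refine ae_restrict_of_forall_mem hS.measurableSet fun v hv => ?_
    refine (EuclideanSpace.norm_le_sum_norm _).trans (Finset.sum_le_sum fun p _ => ?_)
    simp only [fluxKernel, abs_mul]
    have h1 : |v p.1| ≤ max R 0 :=
      ((PiLp.norm_apply_le v p.1).trans (hR v hv)).trans (le_max_left _ _)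
    have h2 := hS.basis.abs_le_one v hv p.2
    nlinarith [abs_nonneg (v p.1), abs_nonneg (S.m v p.2)]

theorem flux_eq {γ : ℝ} {u : EuclideanSpace ℝ (Fin (N + 1))}
    (hα : S.alphaHat γ u ∈ S.negCone) :
    S.flux γ u = S.wMoment S.fluxKernel (S.alphaHat γ u) := by
  obtain ⟨B, hB⟩ := hS.exists_isKernel_fluxKernel
  ext p
  have := (EuclideanSpace.proj p : EuclideanSpace ℝ (Fin d × Fin (N + 1)) →L[ℝ] ℝ).integral_comp_comm
    (hS.integrable_ansatz_smul hB hα)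
  rw [wMoment]
  refine Eq.trans ?_ this
  simp only [flux]
  refine integral_congr_ae (Eventually.of_forall fun v => ?_)
  simp [fluxKernel, mul_comm]

theorem hasFDerivAt_wMoment_alphaHat {F : Type*} [NormedAddCommGroup F] [NormedSpace ℝ F]
    [CompleteSpace F] {k : EuclideanSpace ℝ (Fin d) → F} {B γ : ℝ} (hγ : 0 ≤ γ)
    (hk : S.IsKernel k B)
    {α : EuclideanSpace ℝ (Fin (N + 1))} (hα : α ∈ S.negCone)
    {L : EuclideanSpace ℝ (Fin (N + 1)) →L[ℝ] EuclideanSpace ℝ (Fin (N + 1))}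
    (hL : HasFDerivAt (S.alphaHat γ) L (S.regMap γ α)) :
    HasFDerivAt (fun u => S.wMoment k (S.alphaHat γ u)) (S.wDeriv k α ∘L L) (S.regMap γ α) := by
  have h1 := (hS.hasStrictFDerivAt_wMoment hk hα).hasFDerivAt
  have h2 := hS.alphaHat_regMap hγ hα
  exact HasFDerivAt.comp (g := S.wMoment k) (S.regMap γ α) (h2.symm ▸ h1) hL

theorem alphaHat_eventually_mem {γ : ℝ} (hγ : 0 ≤ γ)
    {α : EuclideanSpace ℝ (Fin (N + 1))} (hα : α ∈ S.negCone)
    (hc : ContinuousAt (S.alphaHat γ) (S.regMap γ α)) :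
    ∀ᶠ u in 𝓝 (S.regMap γ α), S.alphaHat γ u ∈ S.negCone := by
  refine hc.eventually_mem ?_
  rw [hS.alphaHat_regMap hγ hα]
  exact hS.isOpen_negCone.mem_nhds hα

theorem hasFDerivAt_flux {γ : ℝ} (hγ : 0 ≤ γ)
    {α : EuclideanSpace ℝ (Fin (N + 1))} (hα : α ∈ S.negCone)
    {L : EuclideanSpace ℝ (Fin (N + 1)) →L[ℝ] EuclideanSpace ℝ (Fin (N + 1))}
    (hL : HasFDerivAt (S.alphaHat γ) L (S.regMap γ α)) :
    HasFDerivAt (S.flux γ) (S.wDeriv S.fluxKernel α ∘L L) (S.regMap γ α) := by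
  obtain ⟨B, hB⟩ := hS.exists_isKernel_fluxKernel
  exact (hS.hasFDerivAt_wMoment_alphaHat hγ hB hα hL).congr_of_eventually
    ((hS.alphaHat_eventually_mem hγ hα hL.continuousAt).mono fun _ hu => hS.flux_eq hu)

/-- First-order description of the closure at `u = û(α) + γ α`. -/
theorem exists_derivatives {γ l : ℝ} (hγ : 0 ≤ γ) (hl : 0 < l)
    {α : EuclideanSpace ℝ (Fin (N + 1))} (hα : α ∈ S.negCone)
    (hco : ∀ ξ, l * ‖ξ‖ ^ 2 ≤ inner ℝ ξ (S.wDeriv S.m α ξ)) :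
    ∃ L : EuclideanSpace ℝ (Fin (N + 1)) →L[ℝ] EuclideanSpace ℝ (Fin (N + 1)),
      (∀ ξ, L (S.regDeriv γ α ξ) = ξ) ∧ (∀ ξ, S.regDeriv γ α (L ξ) = ξ) ∧ ‖L‖ ≤ l⁻¹ ∧
      HasFDerivAt (S.alphaHat γ) L (S.regMap γ α) ∧
      HasFDerivAt (S.flux γ) (S.wDeriv S.fluxKernel α ∘L L) (S.regMap γ α) := by
  obtain ⟨e, he, hen, hd⟩ := hS.exists_regDeriv_inverse hγ hl hα hco
  have he' : ∀ ξ, S.regDeriv γ α ξ = e ξ := fun ξ => by rw [← he]; rfl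
  refine ⟨e.symm, fun ξ => ?_, fun ξ => ?_, ?_, hd.hasFDerivAt, ?_⟩
  · rw [he', ContinuousLinearEquiv.coe_coe, e.symm_apply_apply]
  · rw [he', ContinuousLinearEquiv.coe_coe, e.apply_symm_apply]
  · exact ContinuousLinearMap.opNorm_le_bound _ (by positivity) hen
  · exact hS.hasFDerivAt_flux hγ hα hd.hasFDerivAt

theorem mem_slab_of_realizableBdd {M p : ℝ}
    {α : EuclideanSpace ℝ (Fin (N + 1))}
    (hα : α ∈ {α | ‖α‖ ≤ M ∧ ∀ v ∈ S.V, inner ℝ α (S.m v) ≤ -p}) : α ∈ S.slab M p :=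
  ⟨hα.1, ae_restrict_of_forall_mem hS.measurableSet hα.2⟩

theorem wellPosed (hN : S.NoConcentration) {M p γ : ℝ} (hp : 0 < p) (hγ : 0 < γ) :
    S.WellPosed γ (S.realizableBdd M p) := by
  have hder : ∀ γ, 0 ≤ γ → ∀ α ∈ S.negCone, DifferentiableAt ℝ (S.alphaHat γ) (S.regMap γ α) ∧
      DifferentiableAt ℝ (S.flux γ) (S.regMap γ α) := by
    intro γ hγ α hα
    obtain ⟨ε, hε, h⟩ := mem_slab_of_negCone hα
    obtain ⟨l, hl, hco, -⟩ := hS.exists_coercive hε (R := ‖α‖)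
    obtain ⟨L, -, -, -, h1, h2⟩ := hS.exists_derivatives hγ hl hα (hco α h)
    exact ⟨h1.differentiableAt, h2.differentiableAt⟩
  have hzero : ∀ α, S.regMap 0 α = S.uHat α := fun α => by simp [regMap]
  have hmem : ∀ u ∈ S.realizableBdd M p, ∃ α ∈ S.negCone, S.regMap 0 α = u := by
    rintro _ ⟨α, hα, rfl⟩
    exact ⟨α, mem_negCone_of_slab hp (hS.mem_slab_of_realizableBdd hα), hzero α⟩
  refine ⟨fun w α => ?_, fun u hu α => ?_, fun u => ?_, fun u _ => ?_, fun u hu => ?_,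
    fun u _ => ?_⟩
  · obtain ⟨hβ, hw⟩ := hS.alphaHat_spec hN hγ w
    have := hS.isDualSolution_iff hγ.le hβ α
    rwa [hw] at this
  · obtain ⟨β, hβ, rfl⟩ := hmem u hu
    rw [hS.alphaHat_regMap le_rfl hβ]
    exact hS.isDualSolution_iff le_rfl hβ α
  · exact (hS.hasGradientAt_entropy hN hγ u).hasFDerivAt.differentiableAt
  · rw [hS.gradient_entropy hN hγ]
    obtain ⟨hβ, hw⟩ := hS.alphaHat_spec hN hγ u
    exact hw ▸ (hder γ hγ.le _ hβ).1
  · obtain ⟨β, hβ, rfl⟩ := hmem u hu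
    exact (hder 0 le_rfl β hβ).2
  · obtain ⟨hβ, hw⟩ := hS.alphaHat_spec hN hγ u
    exact hw ▸ (hder γ hγ.le _ hβ).2

end Regular
end MomentSystem

/-! ### Uniformity in `γ` by compactness, and the near/far dichotomy. -/

namespace MomentSystem

variable {d N : ℕ} {S : MomentSystem d N}

/-- The regularized relative entropy as a function of the multiplier vectors. -/
def relDual (S : MomentSystem d N) (γ : ℝ) (β α : EuclideanSpace ℝ (Fin (N + 1))) : ℝ :=
  S.bregmanInt β α + γ / 2 * ‖β - α‖ ^ 2

/-- Either `β` is near `α` and the relative entropy controls the squared distance, or the relative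
entropy is bounded away from zero and controls the linear quantities. -/
def NearOrFar (S : MomentSystem d N) (R ε A γ : ℝ)
    (β α : EuclideanSpace ℝ (Fin (N + 1))) : Prop :=
  (β ∈ S.slab R ε ∧ ‖β - α‖ ^ 2 ≤ A * S.relDual γ β α) ∨
    (1 ≤ A * S.relDual γ β α ∧
      ∫ v, |S.ansatz β v - S.ansatz α v| ∂S.μ ≤ A * S.relDual γ β α ∧
      γ * ‖β - α‖ ≤ A * S.relDual γ β α)

namespace Regular

variable (hS : S.Regular)
include hS

theorem alphaHat_uHat_spec (hN : S.NoConcentration) {γ : ℝ} (hγ : 0 ≤ γ)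
    {α : EuclideanSpace ℝ (Fin (N + 1))} (hα : α ∈ S.negCone) :
    S.alphaHat γ (S.uHat α) ∈ S.negCone ∧
      S.regMap γ (S.alphaHat γ (S.uHat α)) = S.uHat α := by
  rcases hγ.eq_or_lt with rfl | hγ
  · rw [hS.alphaHat_uHat hα]
    exact ⟨hα, by simp [regMap]⟩
  · exact hS.alphaHat_spec hN hγ _

/-- Strong monotonicity of `û` around the limit multiplier `a` bounds the distance to a nearby
solution `b` by the residual of `a` in the perturbed equation; the extra term `-γ' ‖b - a‖²`, with
`γ'` the perturbed parameter, has the favourable sign. Hence continuity persists at `γ = 0`, where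
the Lipschitz bound `1/γ` is useless. -/
theorem continuousOn_alphaHat_uHat (hN : S.NoConcentration)
    {K : Set (EuclideanSpace ℝ (Fin (N + 1)))} (hK : K ⊆ S.negCone) {γ₀ : ℝ} :
    ContinuousOn (fun q : ℝ × EuclideanSpace ℝ (Fin (N + 1)) => S.alphaHat q.1 (S.uHat q.2))
      (Icc 0 γ₀ ×ˢ K) := by
  rintro ⟨γ, α⟩ ⟨hγ, hα⟩
  obtain ⟨ha, hau⟩ := hS.alphaHat_uHat_spec hN hγ.1 (hK hα)
  set a := S.alphaHat γ (S.uHat α) with had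
  obtain ⟨ε, hε, h⟩ := mem_slab_of_negCone ha
  have hN0 : (0 : ℝ) < (N : ℝ) + 1 := by positivity
  obtain ⟨r, hr0, hr⟩ : ∃ r > 0, r * ((N : ℝ) + 1) ≤ ε / 2 :=
    ⟨ε / 2 / ((N : ℝ) + 1), by positivity, by rw [div_mul_cancel₀ _ hN0.ne']⟩
  have hsub := hS.closedBall_subset_slab hr h
  obtain ⟨l, hl, -, hmono, hconv⟩ := hS.exists_coercive (half_pos hε) (R := ‖a‖ + r)
  have hc : ContinuousWithinAt (fun q : ℝ × EuclideanSpace ℝ (Fin (N + 1)) =>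
      ‖S.uHat q.2 - (S.uHat a + q.1 • a)‖) (Icc 0 γ₀ ×ˢ K) (γ, α) := by
    have h1 : ContinuousAt S.uHat α :=
      (hS.hasStrictFDerivAt_wMoment hS.isKernel_m (hK hα)).continuousAt
    have h2 : ContinuousAt (fun q : ℝ × EuclideanSpace ℝ (Fin (N + 1)) => S.uHat q.2) (γ, α) :=
      ContinuousAt.comp (f := Prod.snd) (x := (γ, α)) h1 continuousAt_snd
    exact (h2.sub (by fun_prop)).norm.continuousWithinAt
  have hz : ‖S.uHat α - (S.uHat a + γ • a)‖ = 0 := by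
    have : S.uHat a + γ • a = S.uHat α := hau
    rw [this, sub_self, norm_zero]
  rw [ContinuousWithinAt] at hc ⊢
  dsimp only at hc
  rw [hz] at hc
  rw [Metric.tendsto_nhds]
  intro δ hδ
  filter_upwards [hc.eventually (gt_mem_nhds (show 0 < l * min r δ by positivity)),
    self_mem_nhdsWithin] with q hq hqm
  obtain ⟨hb, hbu⟩ := hS.alphaHat_uHat_spec hN hqm.1.1 (hK hqm.2)
  rw [dist_eq_norm]
  change ‖S.alphaHat q.1 (S.uHat q.2) - a‖ < δ
  set b := S.alphaHat q.1 (S.uHat q.2) with hbd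
  by_contra! hge
  have hX : 0 < ‖b - a‖ := hδ.trans_le hge
  have h1 := (hS.coercive_of_closedBall (half_pos hε) hr0 hl hsub hmono hconv hb).1
  have h2 : inner ℝ (b - a) (S.uHat b - S.uHat a) =
      inner ℝ (b - a) (S.uHat q.2 - (S.uHat a + q.1 • a)) - q.1 * ‖b - a‖ ^ 2 := by
    rw [← hbu, ← real_inner_self_eq_norm_sq, ← real_inner_smul_right, ← inner_sub_right]
    congr 1
    simp only [regMap, smul_sub]
    abel
  have h3 := real_inner_le_norm (b - a) (S.uHat q.2 - (S.uHat a + q.1 • a))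
  have h4 : 0 ≤ q.1 * ‖b - a‖ ^ 2 := mul_nonneg hqm.1.1 (sq_nonneg _)
  have h5 : ‖b - a‖ * ‖S.uHat q.2 - (S.uHat a + q.1 • a)‖ < ‖b - a‖ * (l * min r δ) := by gcongr
  have h6 : l * min r δ * ‖b - a‖ ≤ l * min r ‖b - a‖ * ‖b - a‖ := by gcongr
  linarith

/-- A `δ`-thickening of `K` stays in the cone. Shifting by `δ` in the first coordinate adds `δ` to
`α ⬝ m`, as `m_0 = 1`, so `α ⬝ m < -δ` on all of `K`; half of this margin pays for the ball. -/
theorem exists_slab_of_isCompact {K : Set (EuclideanSpace ℝ (Fin (N + 1)))} (hK : IsCompact K)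
    (hsub : K ⊆ S.negCone) : ∃ R ε r, 0 < R ∧ 0 < ε ∧ 0 < r ∧
      ∀ α ∈ K, Metric.closedBall α r ⊆ S.slab R ε := by
  obtain ⟨δ, hδ, hδK⟩ := hK.exists_cthickening_subset_open hS.isOpen_negCone hsub
  obtain ⟨R, hR⟩ := hK.isBounded.exists_norm_le
  have hN0 : (0 : ℝ) < (N : ℝ) + 1 := by positivity
  have hr : δ / 2 / ((N : ℝ) + 1) * ((N : ℝ) + 1) ≤ δ / 2 := by rw [div_mul_cancel₀ _ hN0.ne']
  refine ⟨|R| + δ / 2 / ((N : ℝ) + 1), δ / 2, δ / 2 / ((N : ℝ) + 1), by positivity, by positivity,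
    by positivity, fun α hα => ?_⟩
  refine hS.closedBall_subset_slab hr ⟨(hR α hα).trans (le_abs_self R), ?_⟩
  have h1 : α + δ • EuclideanSpace.single (0 : Fin (N + 1)) (1 : ℝ) ∈ S.negCone := by
    refine hδK (Metric.closedBall_subset_cthickening hα δ ?_)
    rw [mem_closedBall_iff_norm, add_sub_cancel_left, norm_smul, Real.norm_of_nonneg hδ.le]
    simp
  filter_upwards [neg_of_mem_negCone h1, hS.inner_single_zero] with v h2 h3
  rw [inner_add_left, real_inner_smul_left, h3] at h2
  linarith

theorem exists_slab_alphaHat (hN : S.NoConcentration) {M p : ℝ} (hp : 0 < p) (γ₀ : ℝ) :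
    ∃ R ε r, 0 < R ∧ 0 < ε ∧ 0 < r ∧
      ∀ α, ‖α‖ ≤ M → (∀ v ∈ S.V, inner ℝ α (S.m v) ≤ -p) → ∀ γ ∈ Icc 0 γ₀,
        Metric.closedBall (S.alphaHat γ (S.uHat α)) r ⊆ S.slab R ε := by
  set K : Set (EuclideanSpace ℝ (Fin (N + 1))) :=
    {α | ‖α‖ ≤ M ∧ ∀ v ∈ S.V, inner ℝ α (S.m v) ≤ -p} with hK
  have hKn : K ⊆ S.negCone := fun α hα =>
    mem_negCone_of_slab hp (hS.mem_slab_of_realizableBdd hα)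
  have hKc : IsCompact K := by
    refine (isCompact_closedBall (0 : EuclideanSpace ℝ (Fin (N + 1))) M).of_isClosed_subset ?_ ?_
    · have : K = {α | ‖α‖ ≤ M} ∩ ⋂ v ∈ S.V, {α | inner ℝ α (S.m v) ≤ -p} := by
        ext α
        simp [hK]
      rw [this]
      refine (isClosed_le continuous_norm continuous_const).inter (isClosed_biInter fun v _ => ?_)
      exact isClosed_le (by fun_prop) continuous_const
    · intro α hα
      simpa using hα.1
  obtain ⟨R, ε, r, hR, hε, hr, h⟩ := hS.exists_slab_of_isCompact
    ((isCompact_Icc.prod hKc).image_of_continuousOn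
      (hS.continuousOn_alphaHat_uHat hN hKn (γ₀ := γ₀))) (by
        rintro _ ⟨q, hq, rfl⟩
        exact (hS.alphaHat_uHat_spec hN hq.1.1 (hKn hq.2)).1)
  exact ⟨R, ε, r, hR, hε, hr, fun α h1 h2 γ hγ =>
    h _ ⟨(γ, α), ⟨hγ, h1, h2⟩, rfl⟩⟩

theorem relDual_nonneg {γ : ℝ} (hγ : 0 ≤ γ) {α β : EuclideanSpace ℝ (Fin (N + 1))}
    (hα : α ∈ S.negCone) (hβ : β ∈ S.negCone) : 0 ≤ S.relDual γ β α := by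
  have := hS.bregmanInt_nonneg hβ (hS.negCone_subset_dualDomain hα)
  unfold relDual
  positivity

theorem integral_abs_ansatz_sub_le {R ε : ℝ} (hε : 0 < ε)
    {α β : EuclideanSpace ℝ (Fin (N + 1))} (hα : α ∈ S.slab R ε) (hβ : β ∈ S.negCone) :
    ∫ v, |S.ansatz β v - S.ansatz α v| ∂S.μ ≤
      2 / ε * S.bregmanInt β α +
        2 * deriv (legendreDual S.η) (-(ε / 2)) * S.μ.real univ := by
  have := hS.isFiniteMeasure
  have hαn := mem_negCone_of_slab hε hα
  have hi := (hS.integrable_bregman hβ (hS.negCone_subset_dualDomain hαn)).const_mul (2 / ε)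
  calc _ ≤ ∫ v, (2 / ε * IsSublinearEntropy.bregman S.η (inner ℝ β (S.m v))
        (inner ℝ α (S.m v)) + 2 * deriv (legendreDual S.η) (-(ε / 2))) ∂S.μ := by
        refine integral_mono_ae
          ((hS.integrable_ansatz hβ).sub (hS.integrable_ansatz hαn)).abs
          (hi.add (integrable_const _)) ?_
        filter_upwards [hα.2, neg_of_mem_negCone hβ] with v h1 h2
        exact hS.entropy.abs_dual_sub_le_bregman hε h2 h1
    _ = _ := by
        rw [integral_add hi (integrable_const _), integral_const_mul, integral_const, bregmanInt,
          smul_eq_mul]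
        ring

theorem exists_nearOrFar {R ε r : ℝ} (hε : 0 < ε) (hr : 0 < r) : ∃ A, 0 < A ∧
    ∀ γ, 0 ≤ γ → ∀ α, Metric.closedBall α r ⊆ S.slab R ε → ∀ β ∈ S.negCone,
      S.NearOrFar R ε A γ β α := by
  obtain ⟨l, hl, -, hmono, hconv⟩ := hS.exists_coercive hε (R := R)
  set P := 2 * deriv (legendreDual S.η) (-(ε / 2)) * S.μ.real univ with hP
  have hP0 : 0 ≤ P := by
    have := hS.entropy.dual_pos (y := -(ε / 2)) (by linarith)
    have := measureReal_nonneg (μ := S.μ) (s := univ)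
    positivity
  set q := (l * r ^ 2)⁻¹ with hq
  have hq0 : 0 < q := by positivity
  -- The term `l⁻¹` serves the near case. In the far case `q` gives `1 ≤ q E`, then `2 / ε + P q`
  -- bounds the `L¹` distance, the additive constant `P` being absorbed by `1 ≤ q E`, and `2 / r`
  -- comes from `r < ‖β - α‖`.
  refine ⟨l⁻¹ + q + 2 / ε + P * q + 2 / r, by positivity, fun γ hγ α hball β hβ => ?_⟩
  have hα : α ∈ S.slab R ε := hball (Metric.mem_closedBall_self hr.le)
  have hαn := mem_negCone_of_slab hε hα
  have hE := hS.relDual_nonneg hγ hαn hβ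
  set E := S.relDual γ β α with hEd
  have hconv' := (hS.coercive_of_closedBall hε hr hl hball hmono hconv hβ).2
  have hb := hS.bregmanInt_nonneg hβ (hS.negCone_subset_dualDomain hαn)
  have hX2 : 0 ≤ γ / 2 * ‖β - α‖ ^ 2 := by positivity
  have hEeq : E = S.bregmanInt β α + γ / 2 * ‖β - α‖ ^ 2 := rfl
  rcases le_or_gt ‖β - α‖ r with hle | hgt
  · left
    refine ⟨hball (mem_closedBall_iff_norm.2 hle), ?_⟩
    rw [min_eq_right hle] at hconv'
    calc ‖β - α‖ ^ 2 = l⁻¹ * (l * ‖β - α‖ ^ 2) := by field_simp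
      _ ≤ l⁻¹ * E := by gcongr; linarith
      _ ≤ _ := by
        gcongr
        have : 0 ≤ q + 2 / ε + P * q + 2 / r := by positivity
        linarith
  · right
    rw [min_eq_left hgt.le] at hconv'
    have h1 : 1 ≤ q * E := by
      rw [hq, ← div_eq_inv_mul, one_le_div (by positivity)]
      linarith
    refine ⟨h1.trans ?_, ?_, ?_⟩
    · gcongr
      have : 0 ≤ l⁻¹ + 2 / ε + P * q + 2 / r := by positivity
      linarith
    · have h2 := hS.integral_abs_ansatz_sub_le hε hα hβ
      rw [← hP] at h2
      calc _ ≤ _ := h2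
        _ ≤ 2 / ε * E + P * (q * E) := by
          have : 2 / ε * S.bregmanInt β α ≤ 2 / ε * E := by gcongr; linarith
          nlinarith
        _ = (2 / ε + P * q) * E := by ring
        _ ≤ _ := by
          refine mul_le_mul_of_nonneg_right ?_ hE
          have : 0 ≤ l⁻¹ + q + 2 / r := by positivity
          linarith
    · calc γ * ‖β - α‖ = 2 / r * (γ / 2 * (r * ‖β - α‖)) := by field_simp
        _ ≤ 2 / r * (γ / 2 * (‖β - α‖ * ‖β - α‖)) := by gcongr
        _ ≤ 2 / r * E := by
          gcongr
          nlinarith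
        _ ≤ _ := by
          gcongr
          have : 0 ≤ l⁻¹ + q + 2 / ε + P * q := by positivity
          linarith

end Regular
end MomentSystem

/-! ### Estimates of the flux and collision defects in multiplier variables. -/

namespace MomentSystem

variable {d N : ℕ} {S : MomentSystem d N}

namespace Regular

variable (hS : S.Regular)
include hS

/-- Transfers the dichotomy from multipliers to moments. Near `α` the linear part `γ id` is
reproduced exactly by the linearization, so the error of `L` is the Taylor remainder of `û` only and
its constant is uniform in `γ`. -/
theorem exists_increment_bounds {R ε : ℝ} (hε : 0 < ε) {l A γ₀ : ℝ} (hl : 0 < l)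
    (hγ₀ : 0 < γ₀) : ∃ C, 0 < C ∧ ∀ γ, 0 < γ → γ < γ₀ → ∀ α ∈ S.slab R ε, ∀ β ∈ S.negCone,
      S.NearOrFar R ε A γ β α →
      ∀ L : EuclideanSpace ℝ (Fin (N + 1)) →L[ℝ] EuclideanSpace ℝ (Fin (N + 1)),
      (∀ ξ, L (S.regDeriv γ α ξ) = ξ) → ‖L‖ ≤ l⁻¹ →
      (β ∈ S.slab R ε ∧ ‖β - α‖ ^ 2 ≤ A * S.relDual γ β α ∧
        ‖L (S.regMap γ β - S.regMap γ α) - (β - α)‖ ≤ C * ‖β - α‖ ^ 2 ∧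
        ‖S.regMap γ β - S.regMap γ α‖ ≤ C * ‖β - α‖) ∨
      (1 ≤ A * S.relDual γ β α ∧
        ∫ v, |S.ansatz β v - S.ansatz α v| ∂S.μ ≤ A * S.relDual γ β α ∧
        ‖S.regMap γ β - S.regMap γ α‖ ≤ C * (A * S.relDual γ β α)) := by
  obtain ⟨Cm, hCm, -, -, htay, hlip⟩ := hS.exists_wMoment_bounds hS.isKernel_m hε (R := R)
  refine ⟨l⁻¹ * Cm + Cm + γ₀ + ((N : ℝ) + 1) + 1, by positivity,
    fun γ hγ hγ1 α hα β hβ hnf L hL hLn => ?_⟩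
  have hαn := mem_negCone_of_slab hε hα
  have hN0 : (0 : ℝ) < (N : ℝ) + 1 := by positivity
  have hc : 0 ≤ l⁻¹ * Cm := by positivity
  have hsplit : S.regMap γ β - S.regMap γ α =
      (S.wMoment S.m β - S.wMoment S.m α) + γ • (β - α) := by
    simp only [regMap, uHat_eq_wMoment, smul_sub]
    abel
  have hΔ : ‖S.regMap γ β - S.regMap γ α‖ ≤
      ‖S.wMoment S.m β - S.wMoment S.m α‖ + γ * ‖β - α‖ := by
    rw [hsplit]
    refine (norm_add_le _ _).trans ?_
    rw [norm_smul, Real.norm_of_nonneg hγ.le]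
  rcases hnf with ⟨hβs, hX⟩ | ⟨h1, h2, h3⟩
  · left
    refine ⟨hβs, hX, ?_, ?_⟩
    · have hrem : L (S.regMap γ β - S.regMap γ α) - (β - α) =
          L (S.wMoment S.m β - S.wMoment S.m α - S.wDeriv S.m α (β - α)) := by
        conv_lhs => rw [← hL (β - α), ← map_sub]
        congr 1
        rw [hsplit]
        simp only [regDeriv, _root_.add_apply, _root_.smul_apply,
          ContinuousLinearMap.id_apply]
        abel
      rw [hrem]
      have h1 := htay α hα β hβs α hα
      rw [sub_self α, norm_zero, add_zero] at h1
      calc _ ≤ ‖L‖ * _ := L.le_opNorm _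
        _ ≤ l⁻¹ * (Cm * ‖β - α‖ * ‖β - α‖) := by gcongr
        _ = l⁻¹ * Cm * ‖β - α‖ ^ 2 := by ring
        _ ≤ _ := by gcongr; linarith
    · calc _ ≤ _ := hΔ
        _ ≤ Cm * ‖β - α‖ + γ₀ * ‖β - α‖ := by
          gcongr
          exact hlip β hβs α hα
        _ = (Cm + γ₀) * ‖β - α‖ := by ring
        _ ≤ _ := mul_le_mul_of_nonneg_right (by linarith) (norm_nonneg _)
  · right
    refine ⟨h1, h2, ?_⟩
    calc _ ≤ _ := hΔ
      _ ≤ ((N : ℝ) + 1) * (A * S.relDual γ β α) + A * S.relDual γ β α := by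
        gcongr
        exact (hS.norm_wMoment_sub_le hS.isKernel_m hαn hβ).trans (by gcongr)
      _ = (((N : ℝ) + 1) + 1) * (A * S.relDual γ β α) := by ring
      _ ≤ _ := by
        refine mul_le_mul_of_nonneg_right ?_ (zero_le_one.trans h1)
        linarith

/-- The flux defect is of order `γ ‖w - u‖`. Near, `γ ‖β - α‖ ≤ ‖β - α‖² + γ²`; far, `‖w - u‖` is
already bounded by the relative entropy and `γ < γ₀`. -/
theorem exists_weighted_increment_bound {R ε : ℝ} (hε : 0 < ε) {l A γ₀ : ℝ} (hl : 0 < l)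
    (hA : 0 < A) (hγ₀ : 0 < γ₀) : ∃ C, 0 < C ∧ ∀ γ, 0 < γ → γ < γ₀ →
      ∀ α ∈ S.slab R ε, ∀ β ∈ S.negCone, S.NearOrFar R ε A γ β α →
      ∀ L : EuclideanSpace ℝ (Fin (N + 1)) →L[ℝ] EuclideanSpace ℝ (Fin (N + 1)),
      (∀ ξ, L (S.regDeriv γ α ξ) = ξ) → ‖L‖ ≤ l⁻¹ →
      γ * ‖S.regMap γ β - S.regMap γ α‖ ≤
        C * ((A + γ₀ * A) * S.relDual γ β α + γ ^ 2) := by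
  obtain ⟨C, hC, hinc⟩ := hS.exists_increment_bounds hε (R := R) (A := A) hl hγ₀
  refine ⟨C, hC, fun γ hγ hγ1 α hα β hβ hnf L hL hLn => ?_⟩
  have hE := hS.relDual_nonneg hγ.le (mem_negCone_of_slab hε hα) hβ
  have h0 : 0 ≤ γ₀ * (A * S.relDual γ β α) := by positivity
  have h2 : 0 ≤ A * S.relDual γ β α := by positivity
  rcases hinc γ hγ hγ1 α hα β hβ hnf L hL hLn with ⟨-, hX, -, h1⟩ | ⟨-, -, h1⟩
  · calc _ ≤ γ * (C * ‖β - α‖) := by gcongr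
      _ = C * (γ * ‖β - α‖) := by ring
      _ ≤ C * (‖β - α‖ ^ 2 + γ ^ 2) := by
        gcongr
        nlinarith [sq_nonneg (‖β - α‖ - γ), sq_nonneg ‖β - α‖, sq_nonneg γ]
      _ ≤ _ := by
        gcongr
        linarith
  · calc _ ≤ γ₀ * (C * (A * S.relDual γ β α)) := by gcongr
      _ = C * (γ₀ * (A * S.relDual γ β α)) := by ring
      _ ≤ _ := by
        gcongr
        linarith [sq_nonneg γ]

section Kernel

variable {F : Type*} [NormedAddCommGroup F] [NormedSpace ℝ F] [CompleteSpace F]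
variable {k : EuclideanSpace ℝ (Fin d) → F} {B : ℝ}

/-- The linearization error of `⟨G k⟩` along the closure is bounded by the relative entropy. -/
theorem exists_relative_moment_bound (hk : S.IsKernel k B) {R ε : ℝ} (hε : 0 < ε) {l A γ₀ : ℝ}
    (hl : 0 < l) (hA : 0 < A) (hγ₀ : 0 < γ₀) : ∃ C, 0 < C ∧ ∀ γ, 0 < γ → γ < γ₀ →
      ∀ α ∈ S.slab R ε, ∀ β ∈ S.negCone, S.NearOrFar R ε A γ β α →
      ∀ L : EuclideanSpace ℝ (Fin (N + 1)) →L[ℝ] EuclideanSpace ℝ (Fin (N + 1)),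
      (∀ ξ, L (S.regDeriv γ α ξ) = ξ) → ‖L‖ ≤ l⁻¹ →
      ‖S.wMoment k β - S.wMoment k α - S.wDeriv k α (L (S.regMap γ β - S.regMap γ α))‖ ≤
        C * S.relDual γ β α := by
  obtain ⟨Ck, hCk, hder, -, htay, -⟩ := hS.exists_wMoment_bounds hk hε (R := R)
  obtain ⟨C, hC, hinc⟩ := hS.exists_increment_bounds hε (R := R) (A := A) hl hγ₀
  have hB := hk.nonneg
  refine ⟨(Ck + Ck * C + B + Ck * (l⁻¹ * C) + 1) * A, by positivity,
    fun γ hγ hγ1 α hα β hβ hnf L hL hLn => ?_⟩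
  have hαn := mem_negCone_of_slab hε hα
  have h0 := mul_nonneg hA.le (hS.relDual_nonneg hγ.le hαn hβ)
  rw [mul_assoc]
  rcases hinc γ hγ hγ1 α hα β hβ hnf L hL hLn with ⟨hβs, hX, hLX, -⟩ | ⟨h1, h2, h3⟩
  · have h1 := htay α hα β hβs α hα
    rw [sub_self α, norm_zero, add_zero] at h1
    -- A Taylor remainder of the moment and the error of replacing `L (w - u)` by `β - α`; both are
    -- quadratic in `‖β - α‖`.
    have h2 : S.wMoment k β - S.wMoment k α - S.wDeriv k α (L (S.regMap γ β - S.regMap γ α)) =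
        (S.wMoment k β - S.wMoment k α - S.wDeriv k α (β - α)) -
          S.wDeriv k α (L (S.regMap γ β - S.regMap γ α) - (β - α)) := by
      rw [map_sub (S.wDeriv k α) (L _)]
      abel
    rw [h2]
    calc _ ≤ _ := norm_sub_le _ _
      _ ≤ Ck * ‖β - α‖ * ‖β - α‖ + Ck * (C * ‖β - α‖ ^ 2) := by
        refine add_le_add h1 (((S.wDeriv k α).le_opNorm _).trans ?_)
        gcongr
        exact hder α hα
      _ = (Ck + Ck * C) * ‖β - α‖ ^ 2 := by ring
      _ ≤ (Ck + Ck * C) * (A * S.relDual γ β α) := by gcongr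
      _ ≤ _ := by
        refine mul_le_mul_of_nonneg_right ?_ h0
        have : 0 ≤ B + Ck * (l⁻¹ * C) := by positivity
        linarith
  · calc _ ≤ _ := norm_sub_le _ _
      _ ≤ B * (A * S.relDual γ β α) + Ck * (l⁻¹ * (C * (A * S.relDual γ β α))) := by
        refine add_le_add ((hS.norm_wMoment_sub_le hk hαn hβ).trans (by gcongr))
          (((S.wDeriv k α).le_opNorm _).trans ?_)
        gcongr
        · exact hder α hα
        · refine (L.le_opNorm _).trans ?_
          gcongr
      _ = (B + Ck * (l⁻¹ * C)) * (A * S.relDual γ β α) := by ring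
      _ ≤ _ := by
        refine mul_le_mul_of_nonneg_right ?_ h0
        have : 0 ≤ Ck + Ck * C := by positivity
        linarith

/-- The regularization changes the derivative of `⟨G k⟩` along the closure by `O(γ)`. -/
theorem exists_deriv_defect_bound (hk : S.IsKernel k B) {R ε : ℝ} (hε : 0 < ε) {l C₀ : ℝ}
    (hl : 0 < l) (hC₀ : 0 ≤ C₀) : ∃ C, 0 < C ∧ ∀ γ, 0 < γ →
      ∀ α ∈ S.slab R ε, ∀ α₀ ∈ S.slab R ε, ‖α - α₀‖ ≤ C₀ * γ →
      ∀ L L₀ : EuclideanSpace ℝ (Fin (N + 1)) →L[ℝ] EuclideanSpace ℝ (Fin (N + 1)),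
      (∀ ξ, L (S.regDeriv γ α ξ) = ξ) → ‖L‖ ≤ l⁻¹ →
      (∀ ξ, S.regDeriv 0 α₀ (L₀ ξ) = ξ) → ‖L₀‖ ≤ l⁻¹ →
      ‖S.wDeriv k α₀ ∘L L₀ - S.wDeriv k α ∘L L‖ ≤ C * γ := by
  obtain ⟨Ck, hCk, hder, hderlip, -, -⟩ := hS.exists_wMoment_bounds hk hε (R := R)
  obtain ⟨Cm, hCm, -, hderm, -, -⟩ := hS.exists_wMoment_bounds hS.isKernel_m hε (R := R)
  refine ⟨Ck * C₀ * l⁻¹ + Ck * (l⁻¹ * ((Cm * C₀ + 1) * l⁻¹)) + 1, by positivity,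
    fun γ hγ α hα α₀ hα₀ hd L L₀ hL hLn hL₀ hL₀n => ?_⟩
  have hL₀' : ∀ ξ, ‖L₀ ξ‖ ≤ l⁻¹ * ‖ξ‖ := fun ξ => L₀.le_of_opNorm_le hL₀n ξ
  refine ContinuousLinearMap.opNorm_le_bound _ (by positivity) fun ξ => ?_
  -- Resolvent identity `L₀ - L = L (T - T₀) L₀` for the inverses of `T = regDeriv γ α` and `T₀ =
  -- regDeriv 0 α₀`.
  have h1 : L₀ ξ - L ξ = L ((S.wDeriv S.m α - S.wDeriv S.m α₀) (L₀ ξ) + γ • L₀ ξ) := by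
    conv_lhs => rw [← hL (L₀ ξ)]
    nth_rw 2 [← hL₀ ξ]
    rw [← map_sub]
    congr 1
    simp only [regDeriv, _root_.add_apply, _root_.smul_apply,
      ContinuousLinearMap.id_apply, _root_.sub_apply, zero_smul]
    abel
  have h2 : ‖L₀ ξ - L ξ‖ ≤ l⁻¹ * ((Cm * C₀ + 1) * γ * (l⁻¹ * ‖ξ‖)) := by
    rw [h1]
    refine (L.le_of_opNorm_le hLn _).trans ?_
    gcongr
    calc _ ≤ _ := norm_add_le _ _
      _ ≤ Cm * (C₀ * γ) * (l⁻¹ * ‖ξ‖) + γ * (l⁻¹ * ‖ξ‖) := by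
        refine add_le_add ?_ ?_
        · refine (ContinuousLinearMap.le_opNorm _ _).trans ?_
          gcongr
          · exact (hderm α hα α₀ hα₀).trans (by gcongr)
          · exact hL₀' ξ
        · rw [norm_smul, Real.norm_of_nonneg hγ.le]
          gcongr
          exact hL₀' ξ
      _ = _ := by ring
  have h3 : (S.wDeriv k α₀ ∘L L₀ - S.wDeriv k α ∘L L) ξ =
      (S.wDeriv k α₀ - S.wDeriv k α) (L₀ ξ) + S.wDeriv k α (L₀ ξ - L ξ) := by
    simp only [_root_.sub_apply, ContinuousLinearMap.comp_apply, map_sub]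
    abel
  rw [h3]
  calc _ ≤ _ := norm_add_le _ _
    _ ≤ Ck * (C₀ * γ) * (l⁻¹ * ‖ξ‖) + Ck * (l⁻¹ * ((Cm * C₀ + 1) * γ * (l⁻¹ * ‖ξ‖))) := by
      refine add_le_add ?_ ?_
      · refine (ContinuousLinearMap.le_opNorm _ _).trans ?_
        gcongr
        · refine (hderlip α₀ hα₀ α hα).trans ?_
          rw [norm_sub_rev]
          gcongr
        · exact hL₀' ξ
      · refine (ContinuousLinearMap.le_of_opNorm_le _ (hder α hα) _).trans ?_
        gcongr
    _ = (Ck * C₀ * l⁻¹ + Ck * (l⁻¹ * ((Cm * C₀ + 1) * l⁻¹))) * γ * ‖ξ‖ := by ring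
    _ ≤ _ := mul_le_mul_of_nonneg_right
      (mul_le_mul_of_nonneg_right (by linarith) hγ.le) (norm_nonneg _)

end Kernel

-- The equation gives `û(α) - û(α₀) = -γ α` with `‖α‖ ≤ R`, and strong monotonicity turns this into
-- a distance of order `γ`.
omit hS in
theorem norm_sub_le_of_regMap_eq {R ε l γ : ℝ} (hl : 0 < l) (hγ : 0 ≤ γ)
    (hmono : ∀ α ∈ S.slab R ε, ∀ β ∈ S.slab R ε,
      l * ‖α - β‖ ^ 2 ≤ inner ℝ (α - β) (S.uHat α - S.uHat β))
    {α α₀ : EuclideanSpace ℝ (Fin (N + 1))} (hα : α ∈ S.slab R ε) (hα₀ : α₀ ∈ S.slab R ε)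
    (h : S.regMap γ α = S.uHat α₀) : ‖α - α₀‖ ≤ R * l⁻¹ * γ := by
  rcases eq_or_ne α α₀ with rfl | hne
  · have : 0 ≤ R := (norm_nonneg _).trans hα.1
    rw [sub_self, norm_zero]
    positivity
  have hX : 0 < ‖α - α₀‖ := norm_sub_pos_iff.2 hne
  have h1 := hmono α hα α₀ hα₀
  have h2 : S.uHat α - S.uHat α₀ = -(γ • α) := by rw [← h, regMap]; abel
  rw [h2] at h1
  have h3 := real_inner_le_norm (α - α₀) (-(γ • α))
  rw [norm_neg, norm_smul, Real.norm_of_nonneg hγ] at h3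
  have h4 : ‖α - α₀‖ * (l * ‖α - α₀‖) ≤ ‖α - α₀‖ * (γ * R) := by
    calc _ = l * ‖α - α₀‖ ^ 2 := by ring
      _ ≤ ‖α - α₀‖ * (γ * ‖α‖) := h1.trans h3
      _ ≤ _ := by gcongr; exact hα.1
  have h5 := le_of_mul_le_mul_left h4 hX
  calc ‖α - α₀‖ = l⁻¹ * (l * ‖α - α₀‖) := by field_simp
    _ ≤ l⁻¹ * (γ * R) := by gcongr
    _ = _ := by ring

/-- The collision term dissipates entropy. -/
theorem inner_source_nonpos (hC : S.CollisionAssumption)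
    {β : EuclideanSpace ℝ (Fin (N + 1))} (hβ : β ∈ S.negCone) :
    inner ℝ β (S.moment (S.coll (S.ansatz β))) ≤ 0 := by
  have hden := hS.ansatz_mem_densities hβ
  have hci := hC.integrable β hden
  -- On the ansatz `η'(G_β) = β ⬝ m`, so the dissipation integral is `β` paired with the collision
  -- moment.
  have h1 : (fun v => deriv S.η (S.ansatz β v) * S.coll (S.ansatz β) v) =ᵐ[S.μ]
      fun v => inner ℝ β (S.coll (S.ansatz β) v • S.m v) := by
    filter_upwards [neg_of_mem_negCone hβ] with v hv
    rw [ansatz, hS.entropy.deriv_dual hv, real_inner_smul_right, mul_comm]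
  have hi := integrable_smul_kernel hS.isKernel_m hci
  have h2 := hC.dissipation _ hden ((hi.const_inner β).congr h1.symm)
  rw [integral_congr_ae h1, integral_inner hi] at h2
  exact h2

theorem source_zero_uHat {β : EuclideanSpace ℝ (Fin (N + 1))} (hβ : β ∈ S.negCone) :
    S.source 0 (S.uHat β) = S.moment (S.coll (S.ansatz β)) := by
  rw [source, hS.alphaHat_uHat hβ]

/-- The estimate of the collision terms in multiplier variables. -/
theorem exists_source_bound (hC : S.CollisionAssumption) {R ε : ℝ} (hε : 0 < ε) (hR : 0 < R)
    {l A γ₀ C₀ : ℝ} (hl : 0 < l) (hA : 0 < A) (hγ₀ : 0 < γ₀) (hC₀ : 0 ≤ C₀) : ∃ C, 0 < C ∧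
      ∀ γ, 0 < γ → γ < γ₀ → ∀ α ∈ S.slab R ε, ∀ α₀ ∈ S.slab R ε, ‖α - α₀‖ ≤ C₀ * γ →
      ∀ β ∈ S.negCone, S.NearOrFar R ε A γ β α →
      ∀ L : EuclideanSpace ℝ (Fin (N + 1)) →L[ℝ] EuclideanSpace ℝ (Fin (N + 1)),
      (∀ ξ, L (S.regDeriv γ α ξ) = ξ) → ‖L‖ ≤ l⁻¹ →
      inner ℝ (β - α) (S.source 0 (S.uHat β)) -
        inner ℝ (S.source 0 (S.uHat α₀)) (L (S.regMap γ β - S.regMap γ α)) ≤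
        C * S.relDual γ β α + C * γ ^ 2 := by
  obtain ⟨K, hK⟩ := hC.lipschitz
  have hKn : 0 ≤ (K : ℝ) := K.2
  have hlipr : ∀ α ∈ S.negCone, ∀ β ∈ S.negCone,
      ‖S.source 0 (S.uHat β) - S.source 0 (S.uHat α)‖ ≤ K * ‖S.uHat β - S.uHat α‖ := by
    intro α hα β hβ
    have := hK.dist_le_mul _ ⟨_, hS.ansatz_mem_densities hβ, rfl⟩ _
      ⟨_, hS.ansatz_mem_densities hα, rfl⟩
    rwa [dist_eq_norm, dist_eq_norm] at this
  obtain ⟨Cm, hCm, -, -, -, hlip⟩ := hS.exists_wMoment_bounds hS.isKernel_m hε (R := R)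
  rw [← uHat_eq_wMoment] at hlip
  -- `û` maps the slab to a bounded set and the collision term is Lipschitz.
  obtain ⟨Q, hQ0, hQ⟩ : ∃ Q, 0 ≤ Q ∧ ∀ α ∈ S.slab R ε, ‖S.source 0 (S.uHat α)‖ ≤ Q := by
    rcases (S.slab R ε).eq_empty_or_nonempty with he | ⟨a, ha⟩
    · exact ⟨0, le_rfl, by simp [he]⟩
    refine ⟨‖S.source 0 (S.uHat a)‖ + K * (Cm * (2 * R)), by positivity, fun α hα => ?_⟩
    have h1 := hlipr a (mem_negCone_of_slab hε ha) α (mem_negCone_of_slab hε hα)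
    have h2 : ‖α - a‖ ≤ 2 * R := (norm_sub_le _ _).trans (by linarith [hα.1, ha.1])
    calc ‖S.source 0 (S.uHat α)‖ = ‖S.source 0 (S.uHat a) +
          (S.source 0 (S.uHat α) - S.source 0 (S.uHat a))‖ := by congr 1; abel
      _ ≤ _ := norm_add_le _ _
      _ ≤ _ := by
        gcongr
        refine h1.trans ?_
        gcongr
        exact (hlip α hα a ha).trans (by gcongr)
  obtain ⟨C, hCpos, hinc⟩ := hS.exists_increment_bounds hε (R := R) (A := A) hl hγ₀
  have hN0 : (0 : ℝ) < (N : ℝ) + 1 := by positivity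
  set a₁ := K * Cm * (1 + C₀) + Q * C with ha₁
  set a₂ := R * (Q + K * ((N : ℝ) + 1)) + Q * (l⁻¹ * C) with ha₂
  have ha₁0 : 0 ≤ a₁ := by positivity
  have ha₂0 : 0 ≤ a₂ := by positivity
  set a₃ := K * Cm * C₀ with ha₃
  have ha₃0 : 0 ≤ a₃ := by positivity
  refine ⟨(a₁ + a₂) * A + a₃ + 1, by positivity,
    fun γ hγ hγ1 α hα α₀ hα₀ hd β hβ hnf L hL hLn => ?_⟩
  have hαn := mem_negCone_of_slab hε hα
  have hα₀n := mem_negCone_of_slab hε hα₀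
  have hE := hS.relDual_nonneg hγ.le hαn hβ
  have hAE := mul_nonneg hA.le hE
  have hQ₀ := hQ α₀ hα₀
  have hfin : ∀ a b : ℝ, 0 ≤ b → a ≤ a₁ + a₂ → b ≤ a₃ →
      a * (A * S.relDual γ β α) + b * γ ^ 2 ≤
        ((a₁ + a₂) * A + a₃ + 1) * S.relDual γ β α + ((a₁ + a₂) * A + a₃ + 1) * γ ^ 2 := by
    intro a b hb0 ha hb
    have e1 := mul_le_mul_of_nonneg_right ha hAE
    have e2 := mul_le_mul_of_nonneg_right hb (sq_nonneg γ)
    have e3 : 0 ≤ (a₃ + 1) * S.relDual γ β α := by positivity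
    have e4 : 0 ≤ ((a₁ + a₂) * A + 1) * γ ^ 2 := by positivity
    linarith
  rcases hinc γ hγ hγ1 α hα β hβ hnf L hL hLn with ⟨hβs, hX, hLX, -⟩ | ⟨h1, h2, h3⟩
  · have h1 : ‖S.source 0 (S.uHat β) - S.source 0 (S.uHat α₀)‖ ≤
        K * (Cm * (‖β - α‖ + C₀ * γ)) := by
      refine (hlipr α₀ hα₀n β hβ).trans ?_
      gcongr
      refine (hlip β hβs α₀ hα₀).trans ?_
      gcongr
      calc ‖β - α₀‖ = ‖(β - α) + (α - α₀)‖ := by congr 1; abel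
        _ ≤ _ := norm_add_le _ _
        _ ≤ _ := by gcongr
    -- Subtracting the collision term at `α₀` leaves a product of `β - α` with a difference of size
    -- `‖β - α‖ + C₀ γ`, and a quadratic linearization error; the mixed product is where `γ²`
    -- appears.
    have h2 : inner ℝ (β - α) (S.source 0 (S.uHat β)) -
        inner ℝ (S.source 0 (S.uHat α₀)) (L (S.regMap γ β - S.regMap γ α)) =
        inner ℝ (β - α) (S.source 0 (S.uHat β) - S.source 0 (S.uHat α₀)) -
        inner ℝ (S.source 0 (S.uHat α₀)) (L (S.regMap γ β - S.regMap γ α) - (β - α)) := by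
      rw [inner_sub_right, inner_sub_right, real_inner_comm (S.source 0 (S.uHat α₀)) (β - α)]
      ring
    rw [h2]
    have h3 := real_inner_le_norm (β - α) (S.source 0 (S.uHat β) - S.source 0 (S.uHat α₀))
    have h4 := abs_real_inner_le_norm (S.source 0 (S.uHat α₀))
      (L (S.regMap γ β - S.regMap γ α) - (β - α))
    have h5 : ‖β - α‖ * ‖S.source 0 (S.uHat β) - S.source 0 (S.uHat α₀)‖ ≤
        ‖β - α‖ * (K * (Cm * (‖β - α‖ + C₀ * γ))) := by gcongr
    have h6 : ‖S.source 0 (S.uHat α₀)‖ * ‖L (S.regMap γ β - S.regMap γ α) - (β - α)‖ ≤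
        Q * (C * ‖β - α‖ ^ 2) := by gcongr
    have h7 : ‖β - α‖ * (K * (Cm * (‖β - α‖ + C₀ * γ))) ≤
        K * Cm * (1 + C₀) * ‖β - α‖ ^ 2 + a₃ * γ ^ 2 := by
      have e1 : ‖β - α‖ * γ ≤ ‖β - α‖ ^ 2 + γ ^ 2 := by
        nlinarith [sq_nonneg (‖β - α‖ - γ), sq_nonneg ‖β - α‖, sq_nonneg γ]
      calc _ = K * Cm * ‖β - α‖ ^ 2 + a₃ * (‖β - α‖ * γ) := by rw [ha₃]; ring
        _ ≤ K * Cm * ‖β - α‖ ^ 2 + a₃ * (‖β - α‖ ^ 2 + γ ^ 2) := by gcongr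
        _ = _ := by rw [ha₃]; ring
    have h8 := neg_abs_le (inner ℝ (S.source 0 (S.uHat α₀))
      (L (S.regMap γ β - S.regMap γ α) - (β - α)))
    have h9 : a₁ * ‖β - α‖ ^ 2 ≤ a₁ * (A * S.relDual γ β α) := by gcongr
    have h10 := hfin a₁ a₃ ha₃0 (by linarith) le_rfl
    have h11 : a₁ * ‖β - α‖ ^ 2 =
        K * Cm * (1 + C₀) * ‖β - α‖ ^ 2 + Q * (C * ‖β - α‖ ^ 2) := by rw [ha₁]; ring
    linarith
  -- No bound on `‖β‖` uniform in `γ` is available here. Dissipation discards its term, which is why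
  -- the estimate is one-sided; what remains grows at most linearly in the `L¹` distance.
  · have hdis : inner ℝ β (S.source 0 (S.uHat β)) ≤ 0 := by
      rw [hS.source_zero_uHat hβ]
      exact hS.inner_source_nonpos hC hβ
    have hrb : ‖S.source 0 (S.uHat β)‖ ≤ (Q + K * ((N : ℝ) + 1)) * (A * S.relDual γ β α) := by
      calc ‖S.source 0 (S.uHat β)‖ = ‖S.source 0 (S.uHat α) +
            (S.source 0 (S.uHat β) - S.source 0 (S.uHat α))‖ := by congr 1; abel
        _ ≤ _ := norm_add_le _ _
        _ ≤ Q + K * (((N : ℝ) + 1) * (A * S.relDual γ β α)) := by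
          refine add_le_add (hQ α hα) ((hlipr α hαn β hβ).trans ?_)
          gcongr
          exact (hS.norm_wMoment_sub_le hS.isKernel_m hαn hβ).trans (by gcongr)
        _ ≤ Q * (A * S.relDual γ β α) + K * (((N : ℝ) + 1) * (A * S.relDual γ β α)) := by
          have := mul_le_mul_of_nonneg_left h1 hQ0
          linarith
        _ = _ := by ring
    have h4 := neg_abs_le (inner ℝ α (S.source 0 (S.uHat β)))
    have h5 := abs_real_inner_le_norm α (S.source 0 (S.uHat β))
    have h6 : ‖α‖ * ‖S.source 0 (S.uHat β)‖ ≤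
        R * ((Q + K * ((N : ℝ) + 1)) * (A * S.relDual γ β α)) := by
      gcongr
      exact hα.1
    have h7 := neg_abs_le (inner ℝ (S.source 0 (S.uHat α₀)) (L (S.regMap γ β - S.regMap γ α)))
    have h8 := abs_real_inner_le_norm (S.source 0 (S.uHat α₀))
      (L (S.regMap γ β - S.regMap γ α))
    have h9 : ‖S.source 0 (S.uHat α₀)‖ * ‖L (S.regMap γ β - S.regMap γ α)‖ ≤
        Q * (l⁻¹ * (C * (A * S.relDual γ β α))) := by
      gcongr
      refine (L.le_of_opNorm_le hLn _).trans ?_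
      gcongr
    have h10 := hfin a₂ 0 le_rfl (by linarith) ha₃0
    rw [inner_sub_left]
    have h11 : a₂ * (A * S.relDual γ β α) =
        R * ((Q + K * ((N : ℝ) + 1)) * (A * S.relDual γ β α)) +
        Q * (l⁻¹ * (C * (A * S.relDual γ β α))) := by rw [ha₂]; ring
    linarith

omit hS in
theorem norm_fluxDefect_le {γ : ℝ}
    {w u : EuclideanSpace ℝ (Fin (N + 1))} {c δ : ℝ} (hc : ‖S.entropyHess γ u‖ ≤ c)
    (hδ : ‖fderiv ℝ (S.flux 0) u - fderiv ℝ (S.flux γ) u‖ ≤ δ) :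
    ‖S.fluxDefect γ w u‖ ≤
      ((Fintype.card (Fin d × Fin (N + 1)) : ℝ) * ((N : ℝ) + 1)) * (‖w - u‖ * c * δ) := by
  have hδ0 : 0 ≤ δ := (norm_nonneg _).trans hδ
  have hc0 : 0 ≤ c := (norm_nonneg _).trans hc
  have hs : ∀ i : Fin (N + 1), ‖(EuclideanSpace.single i (1 : ℝ) :
      EuclideanSpace ℝ (Fin (N + 1)))‖ = 1 := fun i => by simp
  have hterm : ∀ p : Fin d × Fin (N + 1), ∀ j : Fin (N + 1),
      |inner ℝ (w - u) (S.entropyHess γ u (EuclideanSpace.single j 1)) *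
        ((fderiv ℝ (S.flux 0) u - fderiv ℝ (S.flux γ) u)
          (EuclideanSpace.single p.2 1)) (p.1, j)| ≤ ‖w - u‖ * c * δ := by
    intro p j
    rw [abs_mul]
    have h1 : |inner ℝ (w - u) (S.entropyHess γ u (EuclideanSpace.single j 1))| ≤
        ‖w - u‖ * c := by
      refine (abs_real_inner_le_norm _ _).trans ?_
      gcongr
      refine (ContinuousLinearMap.le_of_opNorm_le _ hc _).trans ?_
      rw [hs, mul_one]
    have h2 : |((fderiv ℝ (S.flux 0) u - fderiv ℝ (S.flux γ) u)
          (EuclideanSpace.single p.2 1)) (p.1, j)| ≤ δ := by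
      refine (PiLp.norm_apply_le ((fderiv ℝ (S.flux 0) u - fderiv ℝ (S.flux γ) u)
        (EuclideanSpace.single p.2 1)) (p.1, j)).trans ?_
      refine (ContinuousLinearMap.le_of_opNorm_le _ hδ _).trans ?_
      rw [hs, mul_one]
    gcongr
  refine (EuclideanSpace.norm_le_sum_norm _).trans ?_
  calc _ ≤ ∑ _p : Fin d × Fin (N + 1), ∑ _j : Fin (N + 1), ‖w - u‖ * c * δ := by
        refine Finset.sum_le_sum fun p _ => ?_
        simp only [fluxDefect]
        refine (Finset.abs_sum_le_sum_abs _ _).trans ?_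
        exact Finset.sum_le_sum fun j _ => hterm p j
    _ = _ := by
      simp only [Finset.sum_const, Finset.card_univ, Fintype.card_fin, nsmul_eq_mul]
      push_cast
      ring

end Regular
end MomentSystem

/-! ### Assembly of the uniform constants. -/

theorem mainTheorem8 {d N : ℕ} (S : MomentSystem d N)
    (hVm : MeasurableSet S.V) (hVb : Bornology.IsBounded S.V)
    (hη : IsSublinearEntropy S.η) (hm : S.BasisAssumption)
    (hC : S.CollisionAssumption) (hN : S.NoConcentration)
    (M p γ₀ : ℝ) (hM : 0 < M) (hp : 0 < p) (hγ₀ : 0 < γ₀) :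
    (∀ γ ∈ Set.Ioo 0 γ₀, S.WellPosed γ (S.realizableBdd M p)) ∧
    ∃ Cf CJ DJ Cq Dq : ℝ, 0 < Cf ∧ 0 < CJ ∧ 0 < DJ ∧ 0 < Cq ∧ 0 < Dq ∧
      ∀ w : EuclideanSpace ℝ (Fin (N + 1)), ∀ u ∈ S.realizableBdd M p, ∀ γ ∈ Set.Ioo 0 γ₀,
        ‖S.relFlux γ w u‖ ≤ Cf * S.relEntropy γ w u ∧
        ‖S.fluxDefect γ w u‖ ≤ CJ * S.relEntropy γ w u + DJ * γ ^ 2 ∧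
        S.sourceDefect γ w u ≤ Cq * S.relEntropy γ w u + Dq * γ ^ 2 := by
  have hS : S.Regular := ⟨hVm, hVb, hη, hm⟩
  refine ⟨fun γ hγ => hS.wellPosed hN hp hγ.1, ?_⟩
  obtain ⟨R, ε, r, hR, hε, hr, hball⟩ := hS.exists_slab_alphaHat hN (M := M) hp γ₀
  obtain ⟨l, hl, hco, hmono, -⟩ := hS.exists_coercive hε (R := R)
  obtain ⟨A, hA, hnf⟩ := hS.exists_nearOrFar hε hr (R := R)
  obtain ⟨B, hB⟩ := hS.exists_isKernel_fluxKernel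
  obtain ⟨Cf, hCf, hf⟩ := hS.exists_relative_moment_bound hB hε (R := R) hl hA hγ₀
  have hC₀ : 0 ≤ R * l⁻¹ := by positivity
  obtain ⟨CD, hCD, hD⟩ := hS.exists_deriv_defect_bound hB hε (R := R) hl hC₀
  obtain ⟨Cq, hCq, hq⟩ := hS.exists_source_bound hC hε hR hl hA hγ₀ hC₀
  obtain ⟨Ci, hCi, hinc⟩ := hS.exists_weighted_increment_bound hε (R := R) hl hA hγ₀
  -- Number of summands over all entries of the defect, times the bound `Ci` for `γ ‖w - u‖`, the
  -- Hessian bound `l⁻¹` and the flux derivative bound `CD γ`. It may vanish when `d = 0`, whence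
  -- the added ones below.
  set Z := (Fintype.card (Fin d × Fin (N + 1)) : ℝ) * ((N : ℝ) + 1) * (Ci * l⁻¹ * CD) with hZ
  have hZ0 : 0 ≤ Z := by positivity
  refine ⟨Cf, Z * (A + γ₀ * A) + 1, Z + 1, Cq, Cq, hCf, by positivity, by positivity, hCq, hCq, ?_⟩
  rintro w _ ⟨α₀, hα₀K, rfl⟩ γ ⟨hγ, hγ1⟩
  have hα₀n := MomentSystem.mem_negCone_of_slab hp (hS.mem_slab_of_realizableBdd hα₀K)
  -- The endpoint `γ = 0` places the unregularized multiplier `α₀` in the same slab as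
  -- `α̂_γ(û(α₀))`.
  have hball₀ := hball α₀ hα₀K.1 hα₀K.2 0 ⟨le_rfl, hγ₀.le⟩
  rw [hS.alphaHat_uHat hα₀n] at hball₀
  have hα₀ : α₀ ∈ S.slab R ε := hball₀ (Metric.mem_closedBall_self hr.le)
  have hballα := hball α₀ hα₀K.1 hα₀K.2 γ ⟨hγ.le, hγ1.le⟩
  obtain ⟨hαn, hαu⟩ := hS.alphaHat_uHat_spec hN hγ.le hα₀n
  obtain ⟨hβ, hβw⟩ := hS.alphaHat_spec hN hγ w
  have hrel : S.relEntropy γ w (S.uHat α₀) =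
      S.relDual γ (S.alphaHat γ w) (S.alphaHat γ (S.uHat α₀)) := hS.relEntropy_eq hN hγ _ _
  have hgrad := hS.gradient_entropy hN hγ
  have hfw := hS.flux_eq hβ
  have hfu := hS.flux_eq hαn
  rw [hrel]
  -- The regularized collision term at `w` is the original one at the realizable moment `û(β) = w -
  -- γ β`, where the Lipschitz bound applies even if `w` is not realizable.
  have hsrc : S.source γ w = S.source 0 (S.uHat (S.alphaHat γ w)) := by
    rw [hS.source_zero_uHat hβ, MomentSystem.source]
  have hα : S.alphaHat γ (S.uHat α₀) ∈ S.slab R ε := hballα (Metric.mem_closedBall_self hr.le)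
  have hd := MomentSystem.Regular.norm_sub_le_of_regMap_eq hl hγ.le hmono hα hα₀ hαu
  have hnf' := hnf γ hγ.le _ hballα _ hβ
  obtain ⟨L, hL1, -, hLn, hLd, hLf⟩ := hS.exists_derivatives hγ.le hl hαn (hco _ hα)
  obtain ⟨L₀, -, hL₀2, hL₀n, -, hL₀f⟩ := hS.exists_derivatives le_rfl hl hα₀n (hco _ hα₀)
  have hzero : S.regMap 0 α₀ = S.uHat α₀ := by simp [MomentSystem.regMap]
  rw [hzero] at hL₀f
  rw [hαu] at hLd hLf
  have hΔ : w - S.uHat α₀ = S.regMap γ (S.alphaHat γ w) -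
      S.regMap γ (S.alphaHat γ (S.uHat α₀)) := by rw [hβw, hαu]
  have hHess : S.entropyHess γ (S.uHat α₀) = L := by
    rw [MomentSystem.entropyHess, hgrad, hLd.fderiv]
  have hE := hS.relDual_nonneg hγ.le hαn hβ
  set α := S.alphaHat γ (S.uHat α₀) with hαdef
  set β := S.alphaHat γ w with hβdef
  refine ⟨?_, ?_, ?_⟩
  · rw [MomentSystem.relFlux, hfw, hfu, hLf.fderiv, hΔ]
    exact hf γ hγ hγ1 α hα β hβ hnf' L hL1 hLn
  · have hδ : ‖fderiv ℝ (S.flux 0) (S.uHat α₀) - fderiv ℝ (S.flux γ) (S.uHat α₀)‖ ≤ CD * γ := by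
      rw [hLf.fderiv, hL₀f.fderiv]
      exact hD γ hγ α hα α₀ hα₀ hd L L₀ hL1 hLn hL₀2 hL₀n
    refine (MomentSystem.Regular.norm_fluxDefect_le (c := l⁻¹) (by rw [hHess]; exact hLn) hδ).trans ?_
    rw [hΔ]
    set n := (Fintype.card (Fin d × Fin (N + 1)) : ℝ) * ((N : ℝ) + 1) with hn
    have hn0 : 0 ≤ n := by positivity
    have hAE := mul_nonneg hA.le hE
    have key := hinc γ hγ hγ1 α hα β hβ hnf' L hL1 hLn
    calc _ = n * l⁻¹ * CD * (γ * ‖S.regMap γ β - S.regMap γ α‖) := by ring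
      _ ≤ n * l⁻¹ * CD * (Ci * ((A + γ₀ * A) * S.relDual γ β α + γ ^ 2)) := by gcongr
      _ = Z * (A + γ₀ * A) * S.relDual γ β α + Z * γ ^ 2 := by rw [hZ]; ring
      _ ≤ _ := by
        gcongr <;> linarith
  · rw [MomentSystem.sourceDefect, hHess, hgrad, hsrc, hΔ]
    exact hq γ hγ hγ1 α hα α₀ hα₀ hd β hβ hnf' L hL1 hLn

end
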